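/- Let $\mathcal M=(\mathcal S,\mathcal A,\mathcal P,\mathbf R)$ be an average-reward MDP with finite nonempty state set $\mathcal S$, finite nonempty action sets $\mathcal A_i$ ($i\in\mathcal S$), set of state-action pairs $\mathcal A=\{(i,a_i): a_i\in\mathcal A_i\}$ of cardinality $|\mathcal A|$, transition probabilities $p_{ij}(a_i)$ and rewards in $[0,1]$. For a randomized stationary policy $\pi$ let $\mathbf P^\pi\in\mathbb R^{\mathcal S\times\mathcal S}$ be the induced transition matrix and $\nu^\pi$ its stationary distribution, and assume that $\mathcal M$ is mixing, i.e. that $$t_{\rm mix}=\max_\pi\ \min\Bigl\{t\ge1:\ \max_{q\in\Delta^{\mathcal S}}\bigl\|((\mathbf P^\pi)^\top)^tq-\nu^\pi\bigr\|_1\le\tfrac12\Bigr\}$$ is finite. Let $\mathbf P\in\mathbb R^{\mathcal A\times\mathcal S}$ be the matrix with rows $(p_{ij}(a_i))_j$, and $\hat{\mathbf I}\in\mathbb R^{\mathcal A\times\mathcal S}$ the matrix whose $(i,a_i)$-th row is $e_i$. Let $\mathbf D=[d_1,\dots,d_K]\in\mathbb R^{\mathcal A\times K}$, $K\ge1$,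 have nonnegative entries, let $D=\max_{i,a_i,k}|[d_k]_{i,a_i}|$, and assume that the constrained problem is feasible: there is $\mu\in\Delta^{\mathcal A}$ with $(\hat{\mathbf I}-\mathbf P)^\top\mu=0$ and $\mathbf D^\top\mu\ge\mathbf 1$ (in particular strict feasibility suffices). Assume $K|\mathcal A|\ge2$. With $M=2Dt_{\rm mix}$, consider the minimax problem $$\min_{v\in[-2M,2M]^{\mathcal S},\ s\ge0,\ \sum_ks_k\le2}\ \max_{\mu\in\Delta^{\mathcal A}} f(v,s,\mu),\qquad f(v,s,\mu)=\mu^\top\bigl[(\hat{\mathbf I}-\mathbf P)v+\mathbf Ds\bigr]-\mathbf 1^\top s .$$ The duality gap of a feasible $(v,s,\mu)$ is $\mathrm{Gap}(v,s,\mu)=\max_{\mu'}f(v,s,\mu')-\min_{v',s'}f(v',s',\mu)$ (over the domains above), and a random feasible point is an expected $\epsilon$-approximate solution if $\mathbb E\,\mathrm{Gap}\le\epsilon$. Consider the following algorithm with step sizes $\eta_v,\eta_s,\eta_\mu>0$ and number $T\ge1$. Start at any $v_1\in[-2Dt_{\rm mix},2Dt_{\rm mix}]^{\mathcal S}$, $s_1=\frac1K\mathbf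 1$, $\mu_1=\frac1{|\mathcal A|}\mathbf 1$. For $t=1,\dots,T-1$, with independent draws: * sample $(i,a_i)\sim\mu_t$, $j\sim p_{i\cdot}(a_i)$ and set $\tilde g^v_t=e_i-e_j$; * sample $(i,a_i)\sim\mu_t$, $k$ uniform in $[K]$ and set $\tilde g^s_t=K[d_k]_{i,a_i}e_k-\mathbf 1$; * sample $(i,a_i)$ uniform in $\mathcal A$, $j\sim p_{i\cdot}(a_i)$, $k\sim s_t/\|s_t\|_1$ and set $\tilde g^\mu_t=|\mathcal A|\,\bigl((v_t)_i-(v_t)_j+[d_k]_{i,a_i}\|s_t\|_1\bigr)e_{i,a_i}$ (unbiased estimators of $\nabla_vf,\nabla_sf,\nabla_\mu f$ at $(v_t,s_t,\mu_t)$), and update $$v_{t+1}=\arg\min_{v\in[-2Dt_{\rm mix},2Dt_{\rm mix}]^{\mathcal S}}\langle\eta_v\tilde g^v_t,v\rangle+\tfrac12\|v-v_t\|_2^2,$$ $$s_{t+1}=\arg\min_{s\ge0,\ \sum_ks_k\le2}\langle\eta_s\tilde g^s_t,s\rangle+\sum_ks_k\log\frac{s_k}{(s_t)_k}-\|s\|_1+\|s_t\|_1,$$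 $$\mu_{t+1}=\arg\min_{\mu\in\Delta^{\mathcal A}}-\langle\eta_\mu\tilde g^\mu_t,\mu\rangle+\sum_{x\in\mathcal A}\mu_x\log\frac{\mu_x}{(\mu_t)_x}.$$ Return $\frac1T\sum_{t=1}^T(v_t,s_t,\mu_t)$. There are universal constants $c_v,c_s,c_\mu,C,B>0$ such that for every such instance, every $\epsilon\in(0,1)$ and every such $v_1$, with $$\eta_v=c_v\epsilon,\qquad \eta_s=\frac{c_s\,\epsilon}{KD^2},\qquad \eta_\mu=\frac{c_\mu\,\epsilon}{t_{\rm mix}^2D^2|\mathcal A|},\qquad R=(t_{\rm mix}^2|\mathcal A|+K)\,D^2\,\epsilon^{-2}\log(K|\mathcal A|):$$ for every integer $T\ge CR$ the output is an expected $\epsilon$-approximate solution of the minimax problem, and with $T=\lceil CR\rceil$ the algorithm always takes at most $B\,R$ samples from the transition distributions $p_{i\cdot}(a_i)$, i.e. $O\bigl((t_{\rm mix}^2|\mathcal A|+K)D^2\epsilon^{-2}\log(K|\mathcal A|)\bigr)$ samples. -/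

import Mathlib

open scoped ENNReal

universe u v w

noncomputable section

namespace ConstrainedAMDP

/-! ## Average-reward Markov decision processes and their mixing time -/

/-- An average-reward MDP with finite state set `S` and action sets `A i`; `Σ i, A i` is the set of
state-action pairs. `p x` is the law of the next state after the state-action pair `x`. -/
structure AMDP (S : Type u) (A : S → Type v) where
  p : (Σ i, A i) → PMF S
  r : (Σ i, A i) → ℝ
  r_mem : ∀ x, r x ∈ Set.Icc (0 : ℝ) 1

/-- A randomized stationary policy: for each state a probability vector on its actions. -/
abbrev Policy {S : Type u} (A : S → Type v) [∀ i, Fintype (A i)] : Type (max u v) :=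
  ∀ i, stdSimplex ℝ (A i)

namespace AMDP

variable {S : Type u} {A : S → Type v}

/-- The state-transition matrix `P`, with rows indexed by state-action pairs. -/
def P (M : AMDP S A) : Matrix (Σ i, A i) S ℝ := fun x j => (M.p x j).toReal

/-- The matrix `Î` whose row at the state-action pair `(i, a)` is the basis vector `e_i`. -/
def hatI [DecidableEq S] (A : S → Type v) : Matrix (Σ i, A i) S ℝ :=
  fun x => Pi.single x.1 1

/-- The state-to-state transition matrix of the chain induced by the policy `π`. -/
def Ppol [∀ i, Fintype (A i)] (M : AMDP S A) (π : Policy A) : Matrix S S ℝ :=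
  fun i j => ∑ a, (π i : A i → ℝ) a * M.P ⟨i, a⟩ j

/-- `ν` is a stationary distribution of the chain induced by `π`. -/
def IsStationary [Fintype S] [∀ i, Fintype (A i)] (M : AMDP S A) (π : Policy A)
    (ν : S → ℝ) : Prop :=
  ν ∈ stdSimplex ℝ S ∧ (M.Ppol π).transpose.mulVec ν = ν

/-- The times `t ≥ 1` at which, from every initial distribution, the chain induced by `π` is within
`ℓ₁` distance `1/2` of its stationary distribution. -/
def mixedTimes [Fintype S] [DecidableEq S] [∀ i, Fintype (A i)] (M : AMDP S A)
    (π : Policy A) : Set ℕ :=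
  {t | 1 ≤ t ∧ ∃ ν, M.IsStationary π ν ∧ ∀ q ∈ stdSimplex ℝ S,
    ∑ j, |((M.Ppol π).transpose ^ t).mulVec q j - ν j| ≤ 1 / 2}

/-- The mixing time: the maximum over all policies of the least time in `mixedTimes`; it is `⊤` if
it is not finite. -/
def tmix [Fintype S] [DecidableEq S] [∀ i, Fintype (A i)] (M : AMDP S A) : ℕ∞ :=
  ⨆ π : Policy A, ⨅ t ∈ M.mixedTimes π, (t : ℕ∞)

/-- The AMDP is mixing if its mixing time is finite. -/
def IsMixing [Fintype S] [DecidableEq S] [∀ i, Fintype (A i)] (M : AMDP S A) : Prop :=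
  M.tmix ≠ ⊤

/-- The mixing time of a mixing AMDP as a real number. -/
def mixTime [Fintype S] [DecidableEq S] [∀ i, Fintype (A i)] (M : AMDP S A) : ℝ :=
  (M.tmix.toNat : ℝ)

end AMDP

/-! ## The constrained problem and its minimax formulation -/

/-- The largest absolute value of an entry of the constraint matrix. -/
def maxEntry {ι : Type u} {κ : Type v} (d : Matrix ι κ ℝ) : ℝ :=
  ⨆ e : ι × κ, |d e.1 e.2|

/-- The box `b · [-1, 1]^ι`. -/
def box (ι : Type u) (b : ℝ) : Set (ι → ℝ) := {y | ∀ i, |y i| ≤ b}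

/-- The domain `{s ≥ 0, ∑ s_k ≤ 2}`. -/
def sDomain (κ : Type w) [Fintype κ] : Set (κ → ℝ) := {s | (∀ k, 0 ≤ s k) ∧ ∑ k, s k ≤ 2}

/-- Triples `(v, s, μ)`. -/
abbrev Point (S : Type u) (A : S → Type v) (κ : Type w) : Type (max u v w) :=
  (S → ℝ) × (κ → ℝ) × ((Σ i, A i) → ℝ)

section Problem

variable {S : Type u} {A : S → Type v} {κ : Type w}
  [Fintype S] [DecidableEq S] [∀ i, Fintype (A i)] [Fintype κ]

/-- Some `μ` in the simplex satisfies `(Î - P)ᵀ μ = 0` and `dᵀ μ ≥ 1`. -/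
def IsFeasible (M : AMDP S A) (d : Matrix (Σ i, A i) κ ℝ) : Prop :=
  ∃ μ ∈ stdSimplex ℝ (Σ i, A i),
    (AMDP.hatI A - M.P).transpose.mulVec μ = 0 ∧ ∀ k, 1 ≤ d.transpose.mulVec μ k

/-- `f(v, s, μ) = μᵀ [(Î - P) v + d s] - 1ᵀ s`. -/
def objective (M : AMDP S A) (d : Matrix (Σ i, A i) κ ℝ)
    (v : S → ℝ) (s : κ → ℝ) (μ : (Σ i, A i) → ℝ) : ℝ :=
  dotProduct μ ((AMDP.hatI A - M.P).mulVec v + d.mulVec s) - ∑ k, s k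

/-- `M = 2 D t_mix`. -/
def boundM (M : AMDP S A) (d : Matrix (Σ i, A i) κ ℝ) : ℝ := 2 * maxEntry d * M.mixTime

/-- The domain of the minimizing variables `(v, s)` of the minimax problem. -/
def primalDomain (M : AMDP S A) (d : Matrix (Σ i, A i) κ ℝ) : Set ((S → ℝ) × (κ → ℝ)) :=
  box S (2 * boundM M d) ×ˢ sDomain κ

/-- The duality gap of the minimax problem
`min_{(v, s) ∈ primalDomain} max_{μ ∈ simplex} f(v, s, μ)`. -/
def gap (M : AMDP S A) (d : Matrix (Σ i, A i) κ ℝ) : Point S A κ → ℝ :=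
  fun (v, s, μ) =>
    sSup ((fun μ' => objective M d v s μ') '' stdSimplex ℝ (Σ i, A i)) -
      sInf ((fun y : (S → ℝ) × (κ → ℝ) => objective M d y.1 y.2 μ) '' primalDomain M d)

/-- The random point with law `ρ` is an expected `ε`-approximate solution of the minimax problem:
it is (surely) feasible, and its duality gap has expectation at most `ε`. -/
def IsExpectedApproxSolution (M : AMDP S A) (d : Matrix (Σ i, A i) κ ℝ) (ε : ℝ)
    (ρ : PMF (Point S A κ)) : Prop :=
  (∀ z ∈ ρ.support, (z.1, z.2.1) ∈ primalDomain M d ∧ z.2.2 ∈ stdSimplex ℝ (Σ i, A i)) ∧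
  Summable (fun z => (ρ z).toReal * gap M d z) ∧
  ∑' z, (ρ z).toReal * gap M d z ≤ ε

end Problem

/-! ## Randomized computations with access to a generative model -/

/-- A randomized computation: the joint law of its result and of the number of samples it took from
the generative model. -/
def Sampling (α : Type u) : Type u := PMF (α × ℕ)

namespace Sampling

/-- Return a value without sampling. -/
def ret {α : Type u} (a : α) : Sampling α := PMF.pure (a, 0)

/-- Run `m`, then `f` on its result, adding up the numbers of samples. -/
def bind {α : Type u} {β : Type v} (m : Sampling α) (f : α → Sampling β) : Sampling β :=
  PMF.bind m fun a => PMF.map (fun b : β × ℕ => (b.1, a.2 + b.2)) (f a.1)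

/-- Internal randomness: draw from a known distribution, at no cost. -/
def internal {α : Type u} (q : PMF α) : Sampling α := PMF.map (fun a => (a, 0)) q

/-- The law of the result. -/
def law {α : Type u} (m : Sampling α) : PMF α := PMF.map Prod.fst m

end Sampling

/-- Draw one next state from the generative model at the state-action pair `x`: one sample. -/
def AMDP.query {S : Type u} {A : S → Type v} (M : AMDP S A) (x : Σ i, A i) : Sampling S :=
  PMF.map (fun j => (j, 1)) (M.p x)

/-- The distribution on a finite set proportional to the weights `y ≥ 0` (uniform if all weights
vanish). -/
def proportional {ι : Type u} [Fintype ι] [Nonempty ι] (y : ι → ℝ) : PMF ι :=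
  if h : (∑' i, ENNReal.ofReal (y i)) ≠ 0 then
    PMF.normalize (fun i => ENNReal.ofReal (y i)) h
      (by rw [tsum_fintype]; exact ENNReal.sum_ne_top.2 fun i _ => ENNReal.ofReal_ne_top)
  else PMF.uniformOfFintype ι

/-! ## Stochastic mirror descent -/

/-- A minimizer of `F` over `C` (the minimizer, in all the uses below). -/
def argminOn {E : Type u} [Nonempty E] (C : Set E) (F : E → ℝ) : E :=
  Classical.epsilon fun y => y ∈ C ∧ IsMinOn F C y

/-- `V_y(y') = ½ ‖y - y'‖₂²`. -/
def euclidDiv {ι : Type u} [Fintype ι] (y y' : ι → ℝ) : ℝ := (1 / 2) * ∑ i, (y i - y' i) ^ 2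

/-- The KL divergence `V_y(y') = ∑ y'_i log (y'_i / y_i)`. -/
def klDiv {ι : Type u} [Fintype ι] (y y' : ι → ℝ) : ℝ := ∑ i, y' i * Real.log (y' i / y i)

/-- The rescaled KL divergence `V_y(y') = ∑ y'_i log (y'_i / y_i) - ‖y'‖₁ + ‖y‖₁` (for `y, y' ≥ 0`),
the Bregman divergence of `∑ y_i log y_i`. -/
def rescaledKlDiv {ι : Type u} [Fintype ι] (y y' : ι → ℝ) : ℝ :=
  ∑ i, y' i * Real.log (y' i / y i) - ∑ i, y' i + ∑ i, y i

section Algorithm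

instance sigmaNonempty {S : Type u} {A : S → Type v} [Nonempty S] [∀ i, Nonempty (A i)] :
    Nonempty (Σ i, A i) :=
  ⟨⟨Classical.arbitrary S, Classical.arbitrary _⟩⟩

variable {S : Type u} {A : S → Type v} {κ : Type w}
  [Fintype S] [DecidableEq S] [∀ i, Fintype (A i)] [∀ i, DecidableEq (A i)]
  [Fintype κ] [DecidableEq κ] [Nonempty S] [∀ i, Nonempty (A i)] [Nonempty κ]

/-- Sample `(i, a) ∼ μ`, `j ∼ p_{i·}(a)`; the estimate of `∇_v f = (Î - P)ᵀ μ` is `e_i - e_j`. -/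
def estV (M : AMDP S A) : Point S A κ → Sampling (S → ℝ) :=
  fun (_, _, μ) =>
    (Sampling.internal (proportional μ)).bind fun x =>
    (M.query x).bind fun j =>
    Sampling.ret (Pi.single x.1 1 - Pi.single j 1)

/-- Sample `(i, a) ∼ μ` and `k` uniformly; the estimate of `∇_s f = dᵀ μ - 1` is
`K [d_k]_{i,a} e_k - 1`. -/
def estS (d : Matrix (Σ i, A i) κ ℝ) : Point S A κ → Sampling (κ → ℝ) :=
  fun (_, _, μ) =>
    (Sampling.internal (proportional μ)).bind fun x =>
    (Sampling.internal (PMF.uniformOfFintype κ)).bind fun k =>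
    Sampling.ret (Pi.single k ((Fintype.card κ : ℝ) * d x k) - 1)

/-- Sample `(i, a)` uniformly, `j ∼ p_{i·}(a)` and `k ∼ s / ‖s‖₁`; the estimate of
`∇_μ f = (Î - P) v + d s` is `|A| (v_i - v_j + [d_k]_{i,a} ‖s‖₁) e_{i,a}`. -/
def estMu (M : AMDP S A) (d : Matrix (Σ i, A i) κ ℝ) :
    Point S A κ → Sampling ((Σ i, A i) → ℝ) :=
  fun (v, s, _) =>
    (Sampling.internal (PMF.uniformOfFintype (Σ i, A i))).bind fun x =>
    (M.query x).bind fun j =>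
    (Sampling.internal (proportional s)).bind fun k =>
    Sampling.ret (Pi.single x
      ((Fintype.card (Σ i, A i) : ℝ) * (v x.1 - v j + d x k * ∑ k', |s k'|)))

/-- One iteration: a mirror descent step in `v` and in `s`, a mirror ascent step in `μ`. -/
def smdStep (M : AMDP S A) (d : Matrix (Σ i, A i) κ ℝ) (ηv ηs ημ : ℝ) (z : Point S A κ) :
    Sampling (Point S A κ) :=
  (estV M z).bind fun gv =>
  (estS d z).bind fun gs =>
  (estMu M d z).bind fun gμ =>
  Sampling.ret
    (argminOn (box S (2 * maxEntry d * M.mixTime))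
        (fun v => dotProduct (ηv • gv) v + euclidDiv z.1 v),
      argminOn (sDomain κ)
        (fun s => dotProduct (ηs • gs) s + rescaledKlDiv z.2.1 s),
      argminOn (stdSimplex ℝ (Σ i, A i))
        (fun μ => -dotProduct (ημ • gμ) μ + klDiv z.2.2 μ))

/-- The last iterate and the sum of all iterates, after `n` iterations started at `z₁`. -/
def smdLoop (M : AMDP S A) (d : Matrix (Σ i, A i) κ ℝ) (ηv ηs ημ : ℝ) (z₁ : Point S A κ) :
    ℕ → Sampling (Point S A κ × Point S A κ)
  | 0 => Sampling.ret (z₁, z₁)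
  | n + 1 => (smdLoop M d ηv ηs ημ z₁ n).bind fun y =>
      (smdStep M d ηv ηs ημ y.1).bind fun z => Sampling.ret (z, y.2 + z)

/-- The algorithm: starting at `v₁` and at the uniform vectors `s₁ = (1/K) 1`, `μ₁ = (1/|A|) 1`,
it performs `T - 1` iterations and returns the average of the `T` iterates. -/
def smd (M : AMDP S A) (d : Matrix (Σ i, A i) κ ℝ) (ηv ηs ημ : ℝ) (v₁ : S → ℝ) (T : ℕ) :
    Sampling (Point S A κ) :=
  (smdLoop M d ηv ηs ημ
    (v₁, fun _ => 1 / (Fintype.card κ : ℝ), fun _ => 1 / (Fintype.card (Σ i, A i) : ℝ))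
    (T - 1)).bind fun y => Sampling.ret ((1 / (T : ℝ)) • y.2)

/-- The algorithm with the step sizes `η_v = c_v ε`, `η_s = c_s ε K⁻¹ D⁻²` and
`η_μ = c_μ ε t_mix⁻² D⁻² |A|⁻¹`. -/
def smdWith (cv cs cμ : ℝ) (M : AMDP S A) (d : Matrix (Σ i, A i) κ ℝ) (ε : ℝ) (v₁ : S → ℝ)
    (T : ℕ) : Sampling (Point S A κ) :=
  smd M d (cv * ε)
    (cs * ε / ((Fintype.card κ : ℝ) * maxEntry d ^ 2))
    (cμ * ε / (M.mixTime ^ 2 * maxEntry d ^ 2 * (Fintype.card (Σ i, A i) : ℝ)))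
    v₁ T

/-- `(t_mix² |A| + K) D² ε⁻² log (K |A|)`. -/
def rate (M : AMDP S A) (d : Matrix (Σ i, A i) κ ℝ) (ε : ℝ) : ℝ :=
  (M.mixTime ^ 2 * (Fintype.card (Σ i, A i) : ℝ) + (Fintype.card κ : ℝ)) * maxEntry d ^ 2 / ε ^ 2 *
    Real.log ((Fintype.card κ : ℝ) * (Fintype.card (Σ i, A i) : ℝ))

end Algorithm

end ConstrainedAMDP

end

open ConstrainedAMDP

/-! Since `f` is linear in `(v, s)` and affine in `μ`, the gap of the averaged point is a supremum
over comparators `u` of an average regret `⟨∇f(z_t), z_t - u⟩`, with the signs of the two players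
(`objective_sub_objective`). The proof bounds this supremum run by run and takes expectations only
afterwards, because the maximizing `u` depends on the run.

With the gradient replaced by its estimate `g`, each mirror step costs a telescoping divergence plus
a quadratic term (`next_spec`). For the entropic steps this term is the local norm `∑ y_i G_i²`. An
estimate that picks one of `m` coordinates uniformly and rescales it by `m` has coordinatewise
second moment of order `m` rather than `m²`; this keeps the rate linear in `|A|` and in `K`.

There remains the noise `N = ∑ (∇f - g)`. Paired with the iterates it has mean zero. Paired with `u`
it is controlled by a Fenchel inequality in the same geometry, at the price of a second divergence
from `u`. For `v` this leaves `(η/2) ‖N‖²`, and orthogonality of the increments gives `E ‖N‖² ≤ 2n`.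
For `s` and `μ` it leaves the average over coordinates of `exp(∓η N_i - m)`, where `m` bounds the
logarithm of the exponential moment of `η N_i`; hence its expectation is at most 1, whatever the
number of coordinates (`neg_dotProduct_le_uniform`, `mean_exp_noise_s_le`, `mean_exp_noise_μ_le`).
Together these give `mean_regretBound_le`.

The algorithm keeps `v` in a box of half the radius allowed in the minimax problem. Feasibility
supplies a `μ` at which `f ≥ 0`, and with it the gap over the large box is at most twice the regret
bound over the small one (`gap_le_two_mul`). Mixing enters only through finiteness of `t_mix` and
`t_mix ≥ 1`. The constants are balanced in `regret_constants`. -/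

noncomputable section

namespace ConstrainedAMDP

/-! ## Mirror descent steps -/

section MirrorSteps

/-- `argminOn` is an arbitrary choice among minimizers. An excess `V` that vanishes only at `y`
makes the minimizer unique, so the choice is forced. -/
theorem argminOn_eq_of_forall_add_le {E : Type*} [Nonempty E] {C : Set E} {F V : E → ℝ} {y : E}
    (hy : y ∈ C) (hV : ∀ u ∈ C, 0 ≤ V u) (hV0 : ∀ u ∈ C, V u = 0 → u = y)
    (h : ∀ u ∈ C, F y + V u ≤ F u) : argminOn C F = y := by
  have hmin : y ∈ C ∧ IsMinOn F C y :=
    ⟨hy, isMinOn_iff.2 fun u hu => by linarith [h u hu, hV u hu]⟩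
  have hspec : argminOn C F ∈ C ∧ IsMinOn F C (argminOn C F) :=
    Classical.epsilon_spec (p := fun y => y ∈ C ∧ IsMinOn F C y) ⟨y, hmin⟩
  refine hV0 _ hspec.1 (le_antisymm ?_ (hV _ hspec.1))
  linarith [h _ hspec.1, isMinOn_iff.1 hspec.2 y hy]

variable {ι : Type*} [Fintype ι]

/-- Termwise form with `klFun x = x log x + 1 - x ≥ 0`, which yields both nonnegativity and the case
of equality. -/
theorem rescaledKlDiv_eq_sum_klFun {y : ι → ℝ} (hy : ∀ i, 0 < y i) (u : ι → ℝ) :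
    rescaledKlDiv y u = ∑ i, y i * InformationTheory.klFun (u i / y i) := by
  unfold rescaledKlDiv
  rw [← Finset.sum_sub_distrib, ← Finset.sum_add_distrib]
  refine Finset.sum_congr rfl fun i _ => ?_
  have := (hy i).ne'
  rw [InformationTheory.klFun]
  field_simp
  ring

theorem rescaledKlDiv_nonneg {y u : ι → ℝ} (hy : ∀ i, 0 < y i) (hu : ∀ i, 0 ≤ u i) :
    0 ≤ rescaledKlDiv y u := by
  rw [rescaledKlDiv_eq_sum_klFun hy]
  exact Finset.sum_nonneg fun i _ =>
    mul_nonneg (hy i).le (InformationTheory.klFun_nonneg (div_nonneg (hu i) (hy i).le))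

theorem eq_of_rescaledKlDiv_eq_zero {y u : ι → ℝ} (hy : ∀ i, 0 < y i) (hu : ∀ i, 0 ≤ u i)
    (h : rescaledKlDiv y u = 0) : u = y := by
  rw [rescaledKlDiv_eq_sum_klFun hy, Finset.sum_eq_zero_iff_of_nonneg fun i _ =>
    mul_nonneg (hy i).le (InformationTheory.klFun_nonneg (div_nonneg (hu i) (hy i).le))] at h
  funext i
  have hi := (mul_eq_zero.1 (h i (Finset.mem_univ i))).resolve_left (hy i).ne'
  rw [InformationTheory.klFun_eq_zero_iff (div_nonneg (hu i) (hy i).le),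
    div_eq_one_iff_eq (hy i).ne'] at hi
  exact hi

/-- Change of the base point of the rescaled KL divergence to the multiplicative update. -/
theorem dotProduct_add_rescaledKlDiv {y u G : ι → ℝ} (hy : ∀ i, 0 < y i) {c : ℝ} (hc : 0 < c) :
    dotProduct G u + rescaledKlDiv y u =
      rescaledKlDiv (fun i => c * (y i * Real.exp (-G i))) u + Real.log c * ∑ i, u i +
        ∑ i, y i - ∑ i, c * (y i * Real.exp (-G i)) := by
  have key : ∀ i, G i * u i + u i * Real.log (u i / y i) =
      u i * Real.log (u i / (c * (y i * Real.exp (-G i)))) + Real.log c * u i := by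
    intro i
    -- A zero coordinate contributes nothing, so only the base point has to be positive.
    rcases eq_or_ne (u i) 0 with h | h
    · simp [h]
    · have h1 := (hy i).ne'
      have h2 := (Real.exp_pos (-G i)).ne'
      rw [Real.log_div h h1, Real.log_div h (mul_ne_zero hc.ne' (mul_ne_zero h1 h2)),
        Real.log_mul hc.ne' (mul_ne_zero h1 h2), Real.log_mul h1 h2, Real.log_exp]
      ring
  have := Finset.sum_congr (rfl : (Finset.univ : Finset ι) = _) fun i _ => key i
  rw [Finset.sum_add_distrib, Finset.sum_add_distrib, ← Finset.mul_sum] at this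
  unfold rescaledKlDiv dotProduct
  linarith

/-- The Fenchel inequality for the rescaled KL divergence. -/
theorem sub_sum_le_dotProduct_add_rescaledKlDiv {y u : ι → ℝ} (G : ι → ℝ) (hy : ∀ i, 0 < y i)
    (hu : ∀ i, 0 ≤ u i) :
    ∑ i, y i - ∑ i, y i * Real.exp (-G i) ≤ dotProduct G u + rescaledKlDiv y u := by
  rw [dotProduct_add_rescaledKlDiv hy one_pos]
  have := rescaledKlDiv_nonneg (y := fun i => 1 * (y i * Real.exp (-G i)))
    (fun i => by have := hy i; positivity) hu
  simp only [one_mul, Real.log_one, zero_mul] at this ⊢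
  linarith

theorem exp_le_one_add_add_sq {x : ℝ} (hx : |x| ≤ 1) : Real.exp x ≤ 1 + x + x ^ 2 := by
  have := (abs_le.1 (Real.abs_exp_sub_one_sub_id_le hx)).2
  linarith

/-- The local norm bound for one step. -/
theorem dotProduct_sub_sub_rescaledKlDiv_le {y u G : ι → ℝ} (hy : ∀ i, 0 < y i)
    (hu : ∀ i, 0 ≤ u i) (hG : ∀ i, |G i| ≤ 1) :
    dotProduct G y - dotProduct G u - rescaledKlDiv y u ≤ ∑ i, y i * G i ^ 2 := by
  have h1 := sub_sum_le_dotProduct_add_rescaledKlDiv G hy hu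
  have h2 : ∑ i, y i * Real.exp (-G i) ≤ ∑ i, (y i - G i * y i + y i * G i ^ 2) := by
    refine Finset.sum_le_sum fun i _ => ?_
    have := exp_le_one_add_add_sq (x := -G i) (by rw [abs_neg]; exact hG i)
    nlinarith [hy i]
  rw [Finset.sum_add_distrib, Finset.sum_sub_distrib] at h2
  have h3 : dotProduct G y = ∑ i, G i * y i := rfl
  linarith

/-- The minimizer of a linear function plus the rescaled KL divergence, over a set on which it is
a multiple of the multiplicative update. -/
theorem argminOn_rescaledKlDiv {C : Set (ι → ℝ)} {y G : ι → ℝ} {c : ℝ} {F : (ι → ℝ) → ℝ}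
    (hF : ∀ u ∈ C, F u = dotProduct G u + rescaledKlDiv y u)
    (hC : ∀ u ∈ C, ∀ i, 0 ≤ u i) (hy : ∀ i, 0 < y i) (hc : 0 < c)
    (hmem : (fun i => c * (y i * Real.exp (-G i))) ∈ C)
    (hopt : ∀ u ∈ C, Real.log c * ∑ i, c * (y i * Real.exp (-G i)) ≤ Real.log c * ∑ i, u i) :
    argminOn C F = (fun i => c * (y i * Real.exp (-G i))) ∧
    ∀ u ∈ C, dotProduct G (argminOn C F) + rescaledKlDiv y (argminOn C F) +
      rescaledKlDiv (argminOn C F) u ≤ dotProduct G u + rescaledKlDiv y u := by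
  set y' : ι → ℝ := fun i => c * (y i * Real.exp (-G i)) with hy'
  have hpos : ∀ i, 0 < y' i := fun i => by have := hy i; simp only [hy']; positivity
  have key : ∀ u ∈ C, dotProduct G y' + rescaledKlDiv y y' + rescaledKlDiv y' u ≤
      dotProduct G u + rescaledKlDiv y u := by
    intro u hu
    have h0 : rescaledKlDiv y' y' = 0 := by
      rw [rescaledKlDiv_eq_sum_klFun hpos]
      refine Finset.sum_eq_zero fun i _ => ?_
      rw [div_self (hpos i).ne', InformationTheory.klFun_one, mul_zero]
    -- Moving both sides to base point `y'` cancels everything except the terms `log c * ∑`, which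
    -- are compared by `hopt`.
    rw [dotProduct_add_rescaledKlDiv (u := u) hy hc,
      dotProduct_add_rescaledKlDiv (u := y') hy hc, ← hy', h0]
    linarith [hopt u hu]
  have : argminOn C F = y' := by
    refine argminOn_eq_of_forall_add_le (V := rescaledKlDiv y') hmem
      (fun u hu => rescaledKlDiv_nonneg hpos (hC u hu))
      (fun u hu => eq_of_rescaledKlDiv_eq_zero hpos (hC u hu)) fun u hu => ?_
    rw [hF u hu, hF y' hmem]
    exact key u hu
  refine ⟨this, ?_⟩
  rw [this]
  exact key

/-- One mirror descent step over `{s ≥ 0, ∑ s_k ≤ 2}`. -/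
theorem sDomain_step {y G : ι → ℝ} (hy : ∀ i, 0 < y i) (hG : ∀ i, |G i| ≤ 1) {y' : ι → ℝ}
    (hy' : y' = argminOn (sDomain ι) fun s => dotProduct G s + rescaledKlDiv y s) :
    y' ∈ sDomain ι ∧ (∀ i, 0 < y' i) ∧ ∀ u ∈ sDomain ι,
      dotProduct G y - dotProduct G u ≤
        rescaledKlDiv y u - rescaledKlDiv y' u + ∑ i, y i * G i ^ 2 := by
  have hnn : ∀ i, 0 < y i * Real.exp (-G i) := fun i => by have := hy i; positivity
  obtain ⟨c, hc, hmem, hopt⟩ : ∃ c : ℝ, 0 < c ∧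
      (fun i => c * (y i * Real.exp (-G i))) ∈ sDomain ι ∧
      ∀ u ∈ sDomain ι,
        Real.log c * ∑ i, c * (y i * Real.exp (-G i)) ≤ Real.log c * ∑ i, u i := by
    -- If the multiplicative update has mass at most 2 it is kept, with `c = 1`. Otherwise it is
    -- scaled down to mass exactly 2; then `log c ≤ 0`, and larger mass is better.
    by_cases h : ∑ i, y i * Real.exp (-G i) ≤ 2
    · refine ⟨1, one_pos, ⟨fun i => by simpa using (hnn i).le, by simpa using h⟩, ?_⟩
      simp
    · push Not at h
      have hpos : 0 < ∑ i, y i * Real.exp (-G i) := by linarith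
      have hsum : ∑ i, 2 / (∑ i, y i * Real.exp (-G i)) * (y i * Real.exp (-G i)) = 2 := by
        rw [← Finset.mul_sum, div_mul_cancel₀ _ hpos.ne']
      refine ⟨2 / ∑ i, y i * Real.exp (-G i), by positivity, ⟨fun i => ?_, hsum.le⟩, ?_⟩
      · have := hnn i
        positivity
      · intro u hu
        rw [hsum]
        exact mul_le_mul_of_nonpos_left hu.2
          (Real.log_nonpos (by positivity) ((div_le_one hpos).2 h.le))
  obtain ⟨h1, h2⟩ := argminOn_rescaledKlDiv (F := fun s => dotProduct G s + rescaledKlDiv y s)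
    (fun u _ => rfl) (fun u hu => hu.1) hy hc hmem hopt
  rw [← hy'] at h1 h2
  have hp : ∀ i, 0 < y' i := fun i => by rw [h1]; exact mul_pos hc (hnn i)
  refine ⟨h1 ▸ hmem, hp, fun u hu => ?_⟩
  linarith [h2 u hu, dotProduct_sub_sub_rescaledKlDiv_le hy (fun i => (hp i).le) hG]

theorem klDiv_eq_rescaledKlDiv {y u : ι → ℝ} (hy : y ∈ stdSimplex ℝ ι) (hu : u ∈ stdSimplex ℝ ι) :
    klDiv y u = rescaledKlDiv y u := by
  unfold klDiv rescaledKlDiv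
  rw [hy.2, hu.2]
  ring

/-- One mirror descent step over the simplex. -/
theorem stdSimplex_step [Nonempty ι] {y G : ι → ℝ} (hys : y ∈ stdSimplex ℝ ι)
    (hy : ∀ i, 0 < y i) (hG : ∀ i, |G i| ≤ 1) {y' : ι → ℝ}
    (hy' : y' = argminOn (stdSimplex ℝ ι) fun s => dotProduct G s + klDiv y s) :
    y' ∈ stdSimplex ℝ ι ∧ (∀ i, 0 < y' i) ∧ ∀ u ∈ stdSimplex ℝ ι,
      dotProduct G y - dotProduct G u ≤
        rescaledKlDiv y u - rescaledKlDiv y' u + ∑ i, y i * G i ^ 2 := by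
  have hnn : ∀ i, 0 < y i * Real.exp (-G i) := fun i => by have := hy i; positivity
  have hpos : 0 < ∑ i, y i * Real.exp (-G i) :=
    Finset.sum_pos (fun i _ => hnn i) Finset.univ_nonempty
  have hsum : ∑ i, (∑ i, y i * Real.exp (-G i))⁻¹ * (y i * Real.exp (-G i)) = 1 := by
    rw [← Finset.mul_sum, inv_mul_cancel₀ hpos.ne']
  have hc : 0 < (∑ i, y i * Real.exp (-G i))⁻¹ := by positivity
  have hmem : (fun i => (∑ i, y i * Real.exp (-G i))⁻¹ * (y i * Real.exp (-G i))) ∈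
      stdSimplex ℝ ι := ⟨fun i => (mul_pos hc (hnn i)).le, hsum⟩
  obtain ⟨h1, h2⟩ := argminOn_rescaledKlDiv (C := stdSimplex ℝ ι)
    (F := fun s => dotProduct G s + klDiv y s)
    (fun u hu => by rw [klDiv_eq_rescaledKlDiv hys hu]) (fun u hu => hu.1) hy hc hmem
    (fun u hu => by rw [hsum, hu.2])
  rw [← hy'] at h1 h2
  have hp : ∀ i, 0 < y' i := fun i => by rw [h1]; exact mul_pos hc (hnn i)
  refine ⟨h1 ▸ hmem, hp, fun u hu => ?_⟩
  linarith [h2 u hu, dotProduct_sub_sub_rescaledKlDiv_le hy (fun i => (hp i).le) hG]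

/-- One projected gradient step over a box. -/
theorem box_step {y G : ι → ℝ} {b : ℝ} (hb : 0 ≤ b) {y' : ι → ℝ}
    (hy' : y' = argminOn (box ι b) fun v => dotProduct G v + euclidDiv y v) :
    y' ∈ box ι b ∧ ∀ u ∈ box ι b,
      dotProduct G y - dotProduct G u ≤
        euclidDiv y u - euclidDiv y' u + (1 / 2) * ∑ i, G i ^ 2 := by
  set z : ι → ℝ := fun i => max (-b) (min b (y i - G i)) with hz
  have hzmem : z ∈ box ι b := fun i =>
    abs_le.2 ⟨le_max_left _ _, max_le (by linarith) (min_le_left _ _)⟩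
  have key : ∀ u ∈ box ι b, dotProduct G z + euclidDiv y z + euclidDiv z u ≤
      dotProduct G u + euclidDiv y u := by
    intro u hu
    unfold dotProduct euclidDiv
    rw [Finset.mul_sum, Finset.mul_sum, Finset.mul_sum, ← Finset.sum_add_distrib,
      ← Finset.sum_add_distrib, ← Finset.sum_add_distrib]
    refine Finset.sum_le_sum fun i _ => ?_
    -- First-order optimality of the clipped point: either the derivative vanishes, or it points out
    -- of the interval at the active end.
    have hopt : 0 ≤ (G i + z i - y i) * (u i - z i) := by
      obtain ⟨h1, h2⟩ := abs_le.1 (hu i)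
      simp only [hz]
      rcases le_total b (y i - G i) with h | h
      · rw [min_eq_left h, max_eq_right (by linarith)]
        nlinarith
      · rw [min_eq_right h]
        rcases le_total (-b) (y i - G i) with h' | h'
        · rw [max_eq_right h']
          nlinarith
        · rw [max_eq_left h']
          nlinarith
    nlinarith
  have hnn : ∀ u, 0 ≤ euclidDiv z u := fun u =>
    mul_nonneg (by norm_num) (Finset.sum_nonneg fun i _ => sq_nonneg _)
  have heq : y' = z := by
    rw [hy']
    refine argminOn_eq_of_forall_add_le (V := euclidDiv z) hzmem (fun u _ => hnn u)
      (fun u _ h0 => ?_) key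
    unfold euclidDiv at h0
    have h1 : ∑ i, (z i - u i) ^ 2 = 0 := by linarith
    rw [Finset.sum_eq_zero_iff_of_nonneg fun i _ => sq_nonneg _] at h1
    funext i
    have := pow_eq_zero_iff (two_ne_zero) |>.1 (h1 i (Finset.mem_univ i))
    linarith
  rw [heq]
  refine ⟨hzmem, fun u hu => ?_⟩
  have h2 : dotProduct G y - dotProduct G z - euclidDiv y z ≤ (1 / 2) * ∑ i, G i ^ 2 := by
    unfold dotProduct euclidDiv
    rw [Finset.mul_sum, Finset.mul_sum, ← Finset.sum_sub_distrib, ← Finset.sum_sub_distrib]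
    refine Finset.sum_le_sum fun i _ => ?_
    nlinarith [sq_nonneg (G i - (y i - z i))]
  linarith [key u hu]

end MirrorSteps

/-! ## Expectations under finitely supported distributions -/

section Mean

variable {α : Type*} {β : Type*}

/-- The expectation of `f` under `p`. -/
def mean (p : PMF α) (f : α → ℝ) : ℝ := ∑' a, (p a).toReal * f a

theorem mean_eq_sum {p : PMF α} (hp : p.support.Finite) (f : α → ℝ) :
    mean p f = ∑ a ∈ hp.toFinset, (p a).toReal * f a := by
  refine tsum_eq_sum fun a ha => ?_
  have : p a = 0 := by simpa using ha
  simp [this]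

theorem summable_mean {p : PMF α} (hp : p.support.Finite) (f : α → ℝ) :
    Summable fun a => (p a).toReal * f a := by
  refine summable_of_ne_finset_zero (s := hp.toFinset) fun a ha => ?_
  have : p a = 0 := by simpa using ha
  simp [this]

theorem mean_fintype [Fintype α] (p : PMF α) (f : α → ℝ) :
    mean p f = ∑ a, (p a).toReal * f a :=
  tsum_fintype _

theorem mean_pure (a : α) (f : α → ℝ) : mean (PMF.pure a) f = f a := by
  unfold mean
  rw [tsum_eq_single a fun b hb => by simp [PMF.pure_apply, hb]]
  simp

theorem finite_support_bind {p : PMF α} {q : α → PMF β} (hp : p.support.Finite)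
    (hq : ∀ a ∈ p.support, (q a).support.Finite) : (p.bind q).support.Finite := by
  rw [PMF.support_bind]
  exact hp.biUnion hq

theorem finite_support_map {p : PMF α} (g : α → β) (hp : p.support.Finite) :
    (p.map g).support.Finite := by
  rw [PMF.support_map]
  exact hp.image g

theorem finite_support_pure (a : α) : (PMF.pure a).support.Finite := by
  rw [PMF.support_pure]
  exact Set.finite_singleton a

theorem mean_bind {p : PMF α} {q : α → PMF β} (hp : p.support.Finite)
    (hq : ∀ a ∈ p.support, (q a).support.Finite) (f : β → ℝ) :
    mean (p.bind q) f = mean p fun a => mean (q a) f := by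
  have hb : ∀ b, ((p.bind q) b).toReal = ∑ a ∈ hp.toFinset, (p a).toReal * (q a b).toReal := by
    intro b
    rw [PMF.bind_apply, tsum_eq_sum (s := hp.toFinset) fun a ha => by
      have : p a = 0 := by simpa using ha
      simp [this], ENNReal.toReal_sum fun a _ =>
        ENNReal.mul_ne_top (p.apply_ne_top a) ((q a).apply_ne_top b)]
    simp_rw [ENNReal.toReal_mul]
  rw [mean_eq_sum hp]
  simp_rw [mean, hb, Finset.sum_mul]
  rw [Summable.tsum_finsetSum]
  · refine Finset.sum_congr rfl fun a _ => ?_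
    simp_rw [mul_assoc]
    rw [tsum_mul_left]
  · intro a ha
    simp_rw [mul_assoc]
    exact (summable_mean (hq a (by simpa using ha)) f).mul_left _

theorem mean_map {p : PMF α} (hp : p.support.Finite) (g : α → β) (f : β → ℝ) :
    mean (p.map g) f = mean p fun a => f (g a) := by
  rw [← PMF.bind_pure_comp, mean_bind hp (q := PMF.pure ∘ g) fun a _ => finite_support_pure (g a)]
  simp [mean_pure]

theorem mean_le_mean {p : PMF α} (hp : p.support.Finite) {f g : α → ℝ}
    (h : ∀ a ∈ p.support, f a ≤ g a) : mean p f ≤ mean p g := by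
  rw [mean_eq_sum hp, mean_eq_sum hp]
  exact Finset.sum_le_sum fun a ha =>
    mul_le_mul_of_nonneg_left (h a (by simpa using ha)) ENNReal.toReal_nonneg

theorem mean_const (p : PMF α) (c : ℝ) : mean p (fun _ => c) = c := by
  unfold mean
  rw [tsum_mul_right, ← ENNReal.tsum_toReal_eq p.apply_ne_top, p.tsum_coe]
  simp

theorem mean_add {p : PMF α} (hp : p.support.Finite) (f g : α → ℝ) :
    mean p (fun a => f a + g a) = mean p f + mean p g := by
  simp_rw [mean_eq_sum hp, mul_add, Finset.sum_add_distrib]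

theorem mean_sub {p : PMF α} (hp : p.support.Finite) (f g : α → ℝ) :
    mean p (fun a => f a - g a) = mean p f - mean p g := by
  simp_rw [mean_eq_sum hp, mul_sub, Finset.sum_sub_distrib]

theorem mean_const_mul (p : PMF α) (c : ℝ) (f : α → ℝ) :
    mean p (fun a => c * f a) = c * mean p f := by
  simp_rw [mean, mul_left_comm _ c, tsum_mul_left]

theorem mean_sum {ι : Type*} [Fintype ι] {p : PMF α} (hp : p.support.Finite) (f : ι → α → ℝ) :
    mean p (fun a => ∑ i, f i a) = ∑ i, mean p (f i) := by
  simp_rw [mean_eq_sum hp, Finset.mul_sum]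
  exact Finset.sum_comm

theorem mean_le_of_forall_le {p : PMF α} (hp : p.support.Finite) {f : α → ℝ} {c : ℝ}
    (h : ∀ a ∈ p.support, f a ≤ c) : mean p f ≤ c :=
  (mean_le_mean hp h).trans (mean_const p c).le

theorem mean_mean_sub {p : PMF α} (hp : p.support.Finite) (X : α → ℝ) :
    mean p (fun a => mean p X - X a) = 0 := by
  rw [mean_sub hp, mean_const, sub_self]

/-- The variance is at most the second moment about any point. -/
theorem mean_sq_mean_sub_le {p : PMF α} (hp : p.support.Finite) (X : α → ℝ) (c : ℝ) :
    mean p (fun a => (mean p X - X a) ^ 2) ≤ mean p fun a => (X a - c) ^ 2 := by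
  -- Expansion about the mean; the cross term has expectation zero.
  have h : (fun a => (X a - c) ^ 2) = fun a => (mean p X - X a) ^ 2 +
      ((mean p X - c) ^ 2 + (-2 * (mean p X - c)) * (mean p X - X a)) := by
    funext a
    ring
  rw [h, mean_add hp, mean_add hp, mean_const, mean_const_mul, mean_mean_sub hp]
  nlinarith [sq_nonneg (mean p X - c)]

/-- The exponential moment of a bounded centered random variable. -/
theorem mean_exp_mean_sub_le {p : PMF α} (hp : p.support.Finite) {X : α → ℝ} {l c σ : ℝ}
    (hX : ∀ a ∈ p.support, |l * (mean p X - X a)| ≤ 1) (hσ : mean p (fun a => (X a - c) ^ 2) ≤ σ) :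
    mean p (fun a => Real.exp (l * (mean p X - X a))) ≤ Real.exp (l ^ 2 * σ) := by
  calc mean p (fun a => Real.exp (l * (mean p X - X a)))
      ≤ mean p fun a => 1 + (l * (mean p X - X a) + l ^ 2 * (mean p X - X a) ^ 2) := by
        refine mean_le_mean hp fun a ha => ?_
        have := exp_le_one_add_add_sq (hX a ha)
        rw [mul_pow] at this
        linarith
    _ = 1 + l ^ 2 * mean p fun a => (mean p X - X a) ^ 2 := by
        rw [mean_add hp, mean_add hp, mean_const, mean_const_mul, mean_const_mul,
          mean_mean_sub hp]
        ring
    _ ≤ 1 + l ^ 2 * σ := by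
        gcongr
        exact (mean_sq_mean_sub_le hp X c).trans hσ
    _ ≤ Real.exp (l ^ 2 * σ) := by linarith [Real.add_one_le_exp (l ^ 2 * σ)]

end Mean

/-! ## Laws of randomized computations -/

namespace Sampling

variable {α : Type*} {β : Type*}

theorem law_ret (a : α) : (ret a).law = PMF.pure a := by
  simp [law, ret, PMF.pure_map]

theorem law_internal (q : PMF α) : (internal q).law = q := by
  unfold law internal
  rw [PMF.map_comp]
  exact PMF.map_id q

theorem law_bind (m : Sampling α) (f : α → Sampling β) :
    (m.bind f).law = m.law.bind fun a => (f a).law := by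
  have key (m : PMF (α × ℕ)) (f : α → PMF (β × ℕ)) :
      (m.bind fun a => (f a.1).map fun b : β × ℕ => (b.1, a.2 + b.2)).map Prod.fst =
        (m.map Prod.fst).bind fun a => (f a).map Prod.fst := by
    rw [PMF.map_bind, PMF.bind_map]
    congr 1
    funext a
    rw [PMF.map_comp]
    rfl
  exact key m f

/-- All runs of `m` take exactly `n` samples. -/
def HasCost (m : Sampling α) (n : ℕ) : Prop := ∀ o ∈ PMF.support m, o.2 = n

theorem HasCost.ret (a : α) : (ret a).HasCost 0 := by
  intro o ho
  rw [Sampling.ret, PMF.support_pure, Set.mem_singleton_iff] at ho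
  rw [ho]

theorem HasCost.internal (q : PMF α) : (internal q).HasCost 0 := by
  intro o ho
  rw [Sampling.internal, PMF.support_map] at ho
  obtain ⟨a, -, rfl⟩ := ho
  rfl

theorem HasCost.bind {m : Sampling α} {f : α → Sampling β} {n k : ℕ} (hm : m.HasCost n)
    (hf : ∀ a, (f a).HasCost k) : (m.bind f).HasCost (n + k) := by
  intro o ho
  obtain ⟨a, ha, ho⟩ := (PMF.mem_support_bind_iff _ _ _).1 ho
  obtain ⟨b, hb, rfl⟩ := (PMF.mem_support_map_iff _ _ _).1 ho
  rw [hm a ha, hf _ b hb]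

end Sampling

section Query

variable {S : Type u} {A : S → Type v}

theorem AMDP.law_query (M : AMDP S A) (x : Σ i, A i) : (M.query x).law = M.p x := by
  unfold Sampling.law AMDP.query
  rw [PMF.map_comp]
  exact PMF.map_id _

theorem AMDP.hasCost_query (M : AMDP S A) (x : Σ i, A i) : (M.query x).HasCost 1 := by
  intro o ho
  rw [AMDP.query, PMF.support_map] at ho
  obtain ⟨a, -, rfl⟩ := ho
  rfl

theorem proportional_toReal {ι : Type*} [Fintype ι] [Nonempty ι] {y : ι → ℝ}
    (hy : ∀ i, 0 < y i) (i : ι) : (proportional y i).toReal = y i / ∑ j, y j := by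
  have hsum : ∑' i, ENNReal.ofReal (y i) = ENNReal.ofReal (∑ i, y i) := by
    rw [tsum_fintype, ENNReal.ofReal_sum_of_nonneg fun i _ => (hy i).le]
  have hpos : 0 < ∑ i, y i := Finset.sum_pos (fun i _ => hy i) Finset.univ_nonempty
  have h : (∑' i, ENNReal.ofReal (y i)) ≠ 0 := by
    rw [hsum]
    exact (ENNReal.ofReal_pos.2 hpos).ne'
  rw [proportional, dif_pos h, PMF.normalize_apply, hsum, ENNReal.toReal_mul, ENNReal.toReal_inv,
    ENNReal.toReal_ofReal (hy i).le, ENNReal.toReal_ofReal hpos.le, div_eq_mul_inv]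

theorem uniformOfFintype_toReal {ι : Type*} [Fintype ι] [Nonempty ι] (i : ι) :
    (PMF.uniformOfFintype ι i).toReal = 1 / (Fintype.card ι : ℝ) := by
  simp

theorem AMDP.sum_P [Fintype S] (M : AMDP S A) (x : Σ i, A i) : ∑ j, M.P x j = 1 := by
  have := mean_const (M.p x) 1
  rw [mean_fintype] at this
  simpa [AMDP.P] using this

end Query

/-! ## The stochastic gradient oracle -/

section Oracle

set_option linter.unusedSectionVars false

variable {S : Type u} {A : S → Type v} {κ : Type w}
  [Fintype S] [DecidableEq S] [∀ i, Fintype (A i)] [∀ i, DecidableEq (A i)]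
  [Fintype κ] [DecidableEq κ] [Nonempty S] [∀ i, Nonempty (A i)] [Nonempty κ]

/-- The points that the algorithm can visit. -/
structure IsIterate (b : ℝ) (z : Point S A κ) : Prop where
  v_mem : z.1 ∈ box S b
  s_mem : z.2.1 ∈ sDomain κ
  s_pos : ∀ k, 0 < z.2.1 k
  μ_mem : z.2.2 ∈ stdSimplex ℝ (Σ i, A i)
  μ_pos : ∀ x, 0 < z.2.2 x

/-- The gradient `(∇_v f, ∇_s f, ∇_μ f)` at `z`. -/
def grad (M : AMDP S A) (d : Matrix (Σ i, A i) κ ℝ) (z : Point S A κ) : Point S A κ :=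
  ((AMDP.hatI A - M.P).transpose.mulVec z.2.2, d.transpose.mulVec z.2.2 - 1,
    (AMDP.hatI A - M.P).mulVec z.1 + d.mulVec z.2.1)

theorem law_estV (M : AMDP S A) (z : Point S A κ) :
    (estV M z).law = (proportional z.2.2).bind fun x => (M.p x).bind fun j =>
      PMF.pure (Pi.single x.1 1 - Pi.single j 1) := by
  obtain ⟨v, s, μ⟩ := z
  simp only [estV, Sampling.law_bind, Sampling.law_internal, AMDP.law_query, Sampling.law_ret]

theorem law_estS (d : Matrix (Σ i, A i) κ ℝ) (z : Point S A κ) :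
    (estS d z).law = (proportional z.2.2).bind fun x => (PMF.uniformOfFintype κ).bind fun k =>
      PMF.pure (Pi.single k ((Fintype.card κ : ℝ) * d x k) - 1) := by
  obtain ⟨v, s, μ⟩ := z
  simp only [estS, Sampling.law_bind, Sampling.law_internal, Sampling.law_ret]

theorem law_estMu (M : AMDP S A) (d : Matrix (Σ i, A i) κ ℝ) (z : Point S A κ) :
    (estMu M d z).law = (PMF.uniformOfFintype (Σ i, A i)).bind fun x => (M.p x).bind fun j =>
      (proportional z.2.1).bind fun k => PMF.pure (Pi.single x
        ((Fintype.card (Σ i, A i) : ℝ) * (z.1 x.1 - z.1 j + d x k * ∑ k', |z.2.1 k'|))) := by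
  obtain ⟨v, s, μ⟩ := z
  simp only [estMu, Sampling.law_bind, Sampling.law_internal, AMDP.law_query, Sampling.law_ret]

theorem finite_support_estV (M : AMDP S A) (z : Point S A κ) :
    (estV M z).law.support.Finite := by
  rw [law_estV]
  exact finite_support_bind (Set.toFinite _) fun _ _ =>
    finite_support_bind (Set.toFinite _) fun _ _ => finite_support_pure _

theorem finite_support_estS (d : Matrix (Σ i, A i) κ ℝ) (z : Point S A κ) :
    (estS d z).law.support.Finite := by
  rw [law_estS]
  exact finite_support_bind (Set.toFinite _) fun _ _ =>
    finite_support_bind (Set.toFinite _) fun _ _ => finite_support_pure _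

theorem finite_support_estMu (M : AMDP S A) (d : Matrix (Σ i, A i) κ ℝ) (z : Point S A κ) :
    (estMu M d z).law.support.Finite := by
  rw [law_estMu]
  exact finite_support_bind (Set.toFinite _) fun _ _ =>
    finite_support_bind (Set.toFinite _) fun _ _ =>
      finite_support_bind (Set.toFinite _) fun _ _ => finite_support_pure _

variable {M : AMDP S A} {d : Matrix (Σ i, A i) κ ℝ} {z : Point S A κ} {b D : ℝ}

theorem exists_of_mem_support_estV {g : S → ℝ} (hg : g ∈ (estV M z).law.support) :
    ∃ i j : S, g = Pi.single i 1 - Pi.single j 1 := by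
  rw [law_estV, PMF.mem_support_bind_iff] at hg
  obtain ⟨x, -, hg⟩ := hg
  rw [PMF.mem_support_bind_iff] at hg
  obtain ⟨j, -, hg⟩ := hg
  rw [PMF.support_pure] at hg
  exact ⟨x.1, j, hg⟩

theorem exists_of_mem_support_estS {g : κ → ℝ} (hg : g ∈ (estS d z).law.support) :
    ∃ x k, g = Pi.single k ((Fintype.card κ : ℝ) * d x k) - 1 := by
  rw [law_estS, PMF.mem_support_bind_iff] at hg
  obtain ⟨x, -, hg⟩ := hg
  rw [PMF.mem_support_bind_iff] at hg
  obtain ⟨k, -, hg⟩ := hg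
  rw [PMF.support_pure] at hg
  exact ⟨x, k, hg⟩

theorem exists_of_mem_support_estMu {g : (Σ i, A i) → ℝ} (hg : g ∈ (estMu M d z).law.support) :
    ∃ x j k, g = Pi.single x
      ((Fintype.card (Σ i, A i) : ℝ) * (z.1 x.1 - z.1 j + d x k * ∑ k', |z.2.1 k'|)) := by
  rw [law_estMu, PMF.mem_support_bind_iff] at hg
  obtain ⟨x, -, hg⟩ := hg
  rw [PMF.mem_support_bind_iff] at hg
  obtain ⟨j, -, hg⟩ := hg
  rw [PMF.mem_support_bind_iff] at hg
  obtain ⟨k, -, hg⟩ := hg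
  rw [PMF.support_pure] at hg
  exact ⟨x, j, k, hg⟩

theorem mean_estV (hz : IsIterate b z) (f : (S → ℝ) → ℝ) :
    mean (estV M z).law f =
      ∑ x, z.2.2 x * ∑ j, M.P x j * f (Pi.single x.1 1 - Pi.single j 1) := by
  rw [law_estV, mean_bind (Set.toFinite _) fun _ _ =>
    finite_support_bind (Set.toFinite _) fun _ _ => finite_support_pure _, mean_fintype]
  refine Finset.sum_congr rfl fun x _ => ?_
  rw [mean_bind (Set.toFinite _) fun _ _ => finite_support_pure _, mean_fintype,
    proportional_toReal hz.μ_pos, hz.μ_mem.2, div_one]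
  simp_rw [mean_pure]
  rfl

theorem mean_estS (hz : IsIterate b z) (f : (κ → ℝ) → ℝ) :
    mean (estS d z).law f =
      ∑ x, z.2.2 x * ∑ k, 1 / (Fintype.card κ : ℝ) *
        f (Pi.single k ((Fintype.card κ : ℝ) * d x k) - 1) := by
  rw [law_estS, mean_bind (Set.toFinite _) fun _ _ =>
    finite_support_bind (Set.toFinite _) fun _ _ => finite_support_pure _, mean_fintype]
  refine Finset.sum_congr rfl fun x _ => ?_
  rw [mean_bind (Set.toFinite _) fun _ _ => finite_support_pure _, mean_fintype,
    proportional_toReal hz.μ_pos, hz.μ_mem.2, div_one]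
  simp_rw [mean_pure, uniformOfFintype_toReal]

theorem mean_estMu (hz : IsIterate b z) (f : ((Σ i, A i) → ℝ) → ℝ) :
    mean (estMu M d z).law f =
      ∑ x, 1 / (Fintype.card (Σ i, A i) : ℝ) * ∑ j, M.P x j *
        ∑ k, z.2.1 k / (∑ k', z.2.1 k') * f (Pi.single x
          ((Fintype.card (Σ i, A i) : ℝ) * (z.1 x.1 - z.1 j + d x k * ∑ k', z.2.1 k'))) := by
  have habs : ∑ k', |z.2.1 k'| = ∑ k', z.2.1 k' :=
    Finset.sum_congr rfl fun k _ => abs_of_pos (hz.s_pos k)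
  rw [law_estMu, mean_bind (Set.toFinite _) fun _ _ =>
    finite_support_bind (Set.toFinite _) fun _ _ =>
      finite_support_bind (Set.toFinite _) fun _ _ => finite_support_pure _, mean_fintype]
  refine Finset.sum_congr rfl fun x _ => ?_
  rw [mean_bind (Set.toFinite _) fun _ _ =>
    finite_support_bind (Set.toFinite _) fun _ _ => finite_support_pure _, mean_fintype,
    uniformOfFintype_toReal]
  congr 1
  refine Finset.sum_congr rfl fun j _ => ?_
  rw [mean_bind (Set.toFinite _) fun _ _ => finite_support_pure _, mean_fintype]
  simp_rw [mean_pure, proportional_toReal hz.s_pos, habs]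
  rfl

theorem mean_estV_apply (hz : IsIterate b z) (i : S) :
    mean (estV M z).law (fun g => g i) = (grad M d z).1 i := by
  rw [mean_estV hz]
  simp only [grad, Matrix.mulVec, dotProduct, Matrix.transpose_apply, Matrix.sub_apply]
  refine Finset.sum_congr rfl fun x _ => ?_
  rw [mul_comm]
  congr 1
  simp only [Pi.sub_apply, mul_sub, Finset.sum_sub_distrib]
  rw [← Finset.sum_mul, M.sum_P, one_mul]
  congr 1
  rw [Finset.sum_eq_single i (fun j _ hj => by simp [hj.symm]) (by simp)]
  simp

theorem mean_estS_apply (hz : IsIterate b z) (k : κ) :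
    mean (estS d z).law (fun g => g k) = (grad M d z).2.1 k := by
  rw [mean_estS hz]
  have hK : (Fintype.card κ : ℝ) ≠ 0 := by simp
  have h : ∀ x, ∑ k', 1 / (Fintype.card κ : ℝ) *
      ((Pi.single k' ((Fintype.card κ : ℝ) * d x k') - 1 : κ → ℝ) k) = d x k - 1 := by
    intro x
    simp only [Pi.sub_apply, mul_sub, Finset.sum_sub_distrib, Pi.one_apply]
    congr 1
    · rw [Finset.sum_eq_single k (fun j _ hj => by simp [hj.symm]) (by simp)]
      rw [Pi.single_eq_same]
      field_simp
    · simp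
  simp_rw [h, mul_sub, Finset.sum_sub_distrib, mul_one, hz.μ_mem.2]
  simp only [grad, Matrix.mulVec, dotProduct, Matrix.transpose_apply, Pi.sub_apply, Pi.one_apply]
  congr 1
  exact Finset.sum_congr rfl fun x _ => mul_comm _ _

theorem mean_estMu_apply (hz : IsIterate b z) (x : Σ i, A i) :
    mean (estMu M d z).law (fun g => g x) = (grad M d z).2.2 x := by
  rw [mean_estMu hz]
  have hn : (Fintype.card (Σ i, A i) : ℝ) ≠ 0 := by
    exact_mod_cast Fintype.card_ne_zero
  have hσ : ∑ k', z.2.1 k' ≠ 0 :=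
    (Finset.sum_pos (fun k _ => hz.s_pos k) Finset.univ_nonempty).ne'
  rw [Finset.sum_eq_single x (fun y _ hy => by simp [hy.symm]) (by simp)]
  simp only [Pi.single_eq_same]
  have h : ∀ j, ∑ k, z.2.1 k / (∑ k', z.2.1 k') *
      ((Fintype.card (Σ i, A i) : ℝ) * (z.1 x.1 - z.1 j + d x k * ∑ k', z.2.1 k')) =
      (Fintype.card (Σ i, A i) : ℝ) * (z.1 x.1 - z.1 j + ∑ k, d x k * z.2.1 k) := by
    intro j
    have : ∀ k, z.2.1 k / (∑ k', z.2.1 k') *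
      ((Fintype.card (Σ i, A i) : ℝ) * (z.1 x.1 - z.1 j + d x k * ∑ k', z.2.1 k')) =
      (Fintype.card (Σ i, A i) : ℝ) * ((z.1 x.1 - z.1 j) / (∑ k', z.2.1 k') * z.2.1 k +
        d x k * z.2.1 k) := by
      intro k
      field_simp
    simp_rw [this]
    rw [← Finset.mul_sum, Finset.sum_add_distrib, ← Finset.mul_sum, div_mul_cancel₀ _ hσ]
  simp_rw [h]
  have h2 : ∀ j, M.P x j * ((Fintype.card (Σ i, A i) : ℝ) *
      (z.1 x.1 - z.1 j + ∑ k, d x k * z.2.1 k)) = (Fintype.card (Σ i, A i) : ℝ) *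
      (M.P x j * (z.1 x.1 + ∑ k, d x k * z.2.1 k) - M.P x j * z.1 j) := fun j => by ring
  simp_rw [h2]
  rw [← Finset.mul_sum, ← mul_assoc, one_div_mul_cancel hn, one_mul, Finset.sum_sub_distrib,
    ← Finset.sum_mul, M.sum_P, one_mul]
  simp only [grad, Matrix.mulVec, dotProduct, Pi.add_apply, Matrix.sub_apply, sub_mul,
    Finset.sum_sub_distrib, AMDP.hatI]
  have : ∑ j, (Pi.single x.1 1 : S → ℝ) j * z.1 j = z.1 x.1 := by
    rw [Finset.sum_eq_single x.1 (fun y _ hy => by simp [hy]) (by simp)]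
    simp
  rw [this]
  ring

theorem sum_sq_le_of_mem_support_estV {g : S → ℝ} (hg : g ∈ (estV M z).law.support) :
    ∑ i, g i ^ 2 ≤ 2 := by
  obtain ⟨i, j, rfl⟩ := exists_of_mem_support_estV hg
  calc ∑ k, (Pi.single i 1 - Pi.single j 1 : S → ℝ) k ^ 2
      ≤ ∑ k, ((Pi.single i 1 : S → ℝ) k + (Pi.single j 1 : S → ℝ) k) := by
        refine Finset.sum_le_sum fun k _ => ?_
        simp only [Pi.sub_apply, Pi.single_apply]
        split_ifs <;> norm_num
    _ = 2 := by
        rw [Finset.sum_add_distrib, Finset.sum_pi_single', Finset.sum_pi_single']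
        norm_num

theorem bounds_of_mem_support_estS (hd : ∀ x k, 0 ≤ d x k ∧ d x k ≤ D) {g : κ → ℝ}
    (hg : g ∈ (estS d z).law.support) (k : κ) : 0 ≤ g k + 1 ∧ g k + 1 ≤ Fintype.card κ * D := by
  obtain ⟨x, k', rfl⟩ := exists_of_mem_support_estS hg
  have h1 := hd x k'
  simp only [Pi.sub_apply, Pi.one_apply, sub_add_cancel, Pi.single_apply]
  split_ifs with h
  · exact ⟨by have := h1.1; positivity, by have := h1.2; gcongr⟩
  · exact ⟨le_rfl, by have := h1.1.trans h1.2; positivity⟩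

/-- The estimate plus 1 is supported on the sampled coordinate. A value of order `K D` occurs there
with probability `1/K`, so the second moment about `-1` is `K D²` and not `K² D²`. -/
theorem mean_sq_estS_le (hz : IsIterate b z) (hd : ∀ x k, 0 ≤ d x k ∧ d x k ≤ D) (k : κ) :
    mean (estS d z).law (fun g => (g k - (-1)) ^ 2) ≤ Fintype.card κ * D ^ 2 := by
  rw [mean_estS hz]
  have hK : (0 : ℝ) < Fintype.card κ := by exact_mod_cast Fintype.card_pos
  have h : ∀ x, ∑ k', 1 / (Fintype.card κ : ℝ) *
      ((Pi.single k' ((Fintype.card κ : ℝ) * d x k') - 1 : κ → ℝ) k - (-1)) ^ 2 ≤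
      Fintype.card κ * D ^ 2 := by
    intro x
    rw [Finset.sum_eq_single k (fun j _ hj => by simp [hj.symm]) (by simp)]
    simp only [Pi.sub_apply, Pi.one_apply, Pi.single_eq_same]
    have h1 := hd x k
    have h2 : d x k ^ 2 ≤ D ^ 2 := pow_le_pow_left₀ h1.1 h1.2 2
    have h3 : 1 / (Fintype.card κ : ℝ) * ((Fintype.card κ : ℝ) * d x k - 1 - (-1)) ^ 2 =
        Fintype.card κ * d x k ^ 2 := by
      field_simp
      ring
    rw [h3]
    gcongr
  calc _ ≤ ∑ x, z.2.2 x * (Fintype.card κ * D ^ 2) :=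
        Finset.sum_le_sum fun x _ => mul_le_mul_of_nonneg_left (h x) (hz.μ_pos x).le
    _ = _ := by rw [← Finset.sum_mul, hz.μ_mem.2, one_mul]

theorem abs_increment_le (hz : IsIterate b z) (hd : ∀ x k, 0 ≤ d x k ∧ d x k ≤ D)
    (x : Σ i, A i) (j : S) (k : κ) :
    |z.1 x.1 - z.1 j + d x k * ∑ k', z.2.1 k'| ≤ 2 * b + 2 * D := by
  have h1 := abs_le.1 (hz.v_mem x.1)
  have h2 := abs_le.1 (hz.v_mem j)
  have h3 := hd x k
  have h4 : 0 ≤ ∑ k', z.2.1 k' := Finset.sum_nonneg fun k _ => (hz.s_pos k).le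
  have h5 : d x k * ∑ k', z.2.1 k' ≤ D * 2 :=
    mul_le_mul h3.2 hz.s_mem.2 h4 (h3.1.trans h3.2)
  have h6 := mul_nonneg h3.1 h4
  rw [abs_le]
  constructor <;> linarith

theorem abs_le_of_mem_support_estMu (hz : IsIterate b z) (hd : ∀ x k, 0 ≤ d x k ∧ d x k ≤ D)
    {g : (Σ i, A i) → ℝ} (hg : g ∈ (estMu M d z).law.support) (x : Σ i, A i) :
    |g x| ≤ Fintype.card (Σ i, A i) * (2 * b + 2 * D) := by
  obtain ⟨x', j, k, rfl⟩ := exists_of_mem_support_estMu hg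
  have habs : ∑ k', |z.2.1 k'| = ∑ k', z.2.1 k' :=
    Finset.sum_congr rfl fun k _ => abs_of_pos (hz.s_pos k)
  have h := abs_increment_le hz hd x' j k
  rw [habs, Pi.single_apply]
  split_ifs with hx
  · rw [abs_mul, Nat.abs_cast]
    gcongr
  · rw [abs_zero]
    have := (abs_nonneg _).trans h
    positivity

/-- Coordinate `x` is hit with probability `1/|A|` and then has size at most `|A| (2b + 2D)`; one
factor `|A|` cancels. -/
theorem mean_sq_estMu_le (hz : IsIterate b z) (hd : ∀ x k, 0 ≤ d x k ∧ d x k ≤ D)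
    (x : Σ i, A i) :
    mean (estMu M d z).law (fun g => g x ^ 2) ≤
      Fintype.card (Σ i, A i) * (2 * b + 2 * D) ^ 2 := by
  rw [mean_estMu hz, Finset.sum_eq_single x
    (fun y _ hy => by simp [hy.symm]) (by simp)]
  have hn : (0 : ℝ) < Fintype.card (Σ i, A i) := by exact_mod_cast Fintype.card_pos
  have hσ : 0 < ∑ k', z.2.1 k' := Finset.sum_pos (fun k _ => hz.s_pos k) Finset.univ_nonempty
  set n := (Fintype.card (Σ i, A i) : ℝ)
  set H := 2 * b + 2 * D
  have h1 : ∀ j, ∑ k, z.2.1 k / (∑ k', z.2.1 k') * ((Pi.single x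
      (n * (z.1 x.1 - z.1 j + d x k * ∑ k', z.2.1 k')) : (Σ i, A i) → ℝ) x) ^ 2 ≤
      (n * H) ^ 2 := by
    intro j
    calc _ ≤ ∑ k, z.2.1 k / (∑ k', z.2.1 k') * (n * H) ^ 2 := by
          refine Finset.sum_le_sum fun k _ => ?_
          refine mul_le_mul_of_nonneg_left ?_ (div_nonneg (hz.s_pos k).le hσ.le)
          rw [Pi.single_eq_same]
          refine sq_le_sq' ?_ ?_ <;> have := abs_le.1 (abs_increment_le hz hd x j k) <;> nlinarith
      _ = _ := by rw [← Finset.sum_mul, ← Finset.sum_div, div_self hσ.ne', one_mul]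
  calc _ ≤ 1 / n * ∑ j, M.P x j * (n * H) ^ 2 := by
        refine mul_le_mul_of_nonneg_left (Finset.sum_le_sum fun j _ => ?_) (by positivity)
        exact mul_le_mul_of_nonneg_left (h1 j) ENNReal.toReal_nonneg
    _ = n * H ^ 2 := by
        rw [← Finset.sum_mul, M.sum_P]
        field_simp

/-! ### The joint law of the three estimates -/

/-- The joint law of the estimates of the gradient at `z`. -/
def oracle (M : AMDP S A) (d : Matrix (Σ i, A i) κ ℝ) (z : Point S A κ) : PMF (Point S A κ) :=
  (estV M z).law.bind fun gv => (estS d z).law.bind fun gs =>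
    (estMu M d z).law.map fun gμ => (gv, gs, gμ)

theorem finite_support_oracle (M : AMDP S A) (d : Matrix (Σ i, A i) κ ℝ) (z : Point S A κ) :
    (oracle M d z).support.Finite :=
  finite_support_bind (finite_support_estV M z) fun _ _ =>
    finite_support_bind (finite_support_estS d z) fun _ _ =>
      finite_support_map _ (finite_support_estMu M d z)

theorem mem_support_of_mem_support_oracle {g : Point S A κ} (hg : g ∈ (oracle M d z).support) :
    g.1 ∈ (estV M z).law.support ∧ g.2.1 ∈ (estS d z).law.support ∧
      g.2.2 ∈ (estMu M d z).law.support := by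
  rw [oracle, PMF.mem_support_bind_iff] at hg
  obtain ⟨gv, hv, hg⟩ := hg
  rw [PMF.mem_support_bind_iff] at hg
  obtain ⟨gs, hs, hg⟩ := hg
  rw [PMF.support_map] at hg
  obtain ⟨gμ, hμ, rfl⟩ := hg
  exact ⟨hv, hs, hμ⟩

theorem mean_oracle (M : AMDP S A) (d : Matrix (Σ i, A i) κ ℝ) (z : Point S A κ)
    (f : Point S A κ → ℝ) :
    mean (oracle M d z) f = mean (estV M z).law fun gv => mean (estS d z).law fun gs =>
      mean (estMu M d z).law fun gμ => f (gv, gs, gμ) := by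
  rw [oracle, mean_bind (finite_support_estV M z) fun _ _ =>
    finite_support_bind (finite_support_estS d z) fun _ _ =>
      finite_support_map _ (finite_support_estMu M d z)]
  congr 1
  funext gv
  rw [mean_bind (finite_support_estS d z) fun _ _ =>
      finite_support_map _ (finite_support_estMu M d z)]
  congr 1
  funext gs
  rw [mean_map (finite_support_estMu M d z)]

theorem mean_oracle_v (f : (S → ℝ) → ℝ) :
    mean (oracle M d z) (fun g => f g.1) = mean (estV M z).law f := by
  simp_rw [mean_oracle, mean_const]

theorem mean_oracle_s (f : (κ → ℝ) → ℝ) :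
    mean (oracle M d z) (fun g => f g.2.1) = mean (estS d z).law f := by
  simp_rw [mean_oracle, mean_const]

theorem mean_oracle_μ (f : ((Σ i, A i) → ℝ) → ℝ) :
    mean (oracle M d z) (fun g => f g.2.2) = mean (estMu M d z).law f := by
  simp_rw [mean_oracle, mean_const]

end Oracle

/-! ## The regret along a run of the algorithm -/

section Trace

set_option linter.unusedSectionVars false

variable {S : Type u} {A : S → Type v} {κ : Type w}
  [Fintype S] [DecidableEq S] [∀ i, Fintype (A i)] [∀ i, DecidableEq (A i)]
  [Fintype κ] [DecidableEq κ] [Nonempty S] [∀ i, Nonempty (A i)] [Nonempty κ]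

/-- The bound `2 b + 2 D` on the increments `v_i - v_j + [d_k]_{i,a} ‖s‖₁`, with `b = 2 D t_mix`. -/
def incrBound (M : AMDP S A) (d : Matrix (Σ i, A i) κ ℝ) : ℝ :=
  2 * (2 * maxEntry d * M.mixTime) + 2 * maxEntry d

/-- The conditions under which one iteration is analysed. -/
structure IsAdmissible (M : AMDP S A) (d : Matrix (Σ i, A i) κ ℝ) (ηv ηs ημ : ℝ) : Prop where
  d_nonneg : ∀ x k, 0 ≤ d x k
  one_le_maxEntry : 1 ≤ maxEntry d
  one_le_mixTime : 1 ≤ M.mixTime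
  ηv_pos : 0 < ηv
  ηs_pos : 0 < ηs
  ημ_pos : 0 < ημ
  ηs_le : ηs * (2 * (Fintype.card κ * maxEntry d)) ≤ 1
  ημ_le : ημ * (2 * (Fintype.card (Σ i, A i) * incrBound M d)) ≤ 1

theorem le_maxEntry (d : Matrix (Σ i, A i) κ ℝ) (x : Σ i, A i) (k : κ) : d x k ≤ maxEntry d :=
  (le_abs_self _).trans
    (le_ciSup (f := fun e : (Σ i, A i) × κ => |d e.1 e.2|) (Set.finite_range _).bddAbove (x, k))

/-- The iterate that follows `z` when the gradient estimates are `g`. -/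
def next (M : AMDP S A) (d : Matrix (Σ i, A i) κ ℝ) (ηv ηs ημ : ℝ) (z g : Point S A κ) :
    Point S A κ :=
  (argminOn (box S (2 * maxEntry d * M.mixTime))
      (fun v => dotProduct (ηv • g.1) v + euclidDiv z.1 v),
    argminOn (sDomain κ)
      (fun s => dotProduct (ηs • g.2.1) s + rescaledKlDiv z.2.1 s),
    argminOn (stdSimplex ℝ (Σ i, A i))
      (fun μ => -dotProduct (ημ • g.2.2) μ + klDiv z.2.2 μ))

theorem law_smdStep (M : AMDP S A) (d : Matrix (Σ i, A i) κ ℝ) (ηv ηs ημ : ℝ) (z : Point S A κ) :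
    (smdStep M d ηv ηs ημ z).law = (oracle M d z).map (next M d ηv ηs ημ z) := by
  simp only [smdStep, Sampling.law_bind, Sampling.law_ret, oracle, PMF.map_bind, PMF.map_comp]
  rfl

/-- The total divergence from `z` to `u`, weighted by the inverse step sizes. -/
def weightedDiv (ηv ηs ημ : ℝ) (z u : Point S A κ) : ℝ :=
  1 / ηv * euclidDiv z.1 u.1 + 1 / ηs * rescaledKlDiv z.2.1 u.2.1 +
    1 / ημ * rescaledKlDiv z.2.2 u.2.2

/-- The pairing of gradients and points, with the sign of each player. -/
def signedPairing (g u : Point S A κ) : ℝ :=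
  dotProduct g.1 u.1 + dotProduct g.2.1 u.2.1 - dotProduct g.2.2 u.2.2

/-- The contribution of one iteration to the regret that does not depend on the comparator. -/
def stepError (M : AMDP S A) (d : Matrix (Σ i, A i) κ ℝ) (ηs ημ : ℝ) (z g : Point S A κ) : ℝ :=
  signedPairing (grad M d z - g) z + (ηs * ∑ k, z.2.1 k * g.2.1 k ^ 2 +
    ημ * ∑ x, z.2.2 x * g.2.2 x ^ 2)

/-- The comparators with `v` in the box of the algorithm. -/
def comparators (M : AMDP S A) (d : Matrix (Σ i, A i) κ ℝ) : Set (Point S A κ) :=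
  box S (2 * maxEntry d * M.mixTime) ×ˢ (sDomain κ ×ˢ stdSimplex ℝ (Σ i, A i))

variable {M : AMDP S A} {d : Matrix (Σ i, A i) κ ℝ} {ηv ηs ημ : ℝ} {z g u : Point S A κ}

theorem IsAdmissible.d_bounds (h : IsAdmissible M d ηv ηs ημ) (x : Σ i, A i) (k : κ) :
    0 ≤ d x k ∧ d x k ≤ maxEntry d :=
  ⟨h.d_nonneg x k, le_maxEntry d x k⟩

theorem IsAdmissible.incrBound_pos (h : IsAdmissible M d ηv ηs ημ) : 0 < incrBound M d := by
  have h1 := h.one_le_maxEntry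
  have h2 := h.one_le_mixTime
  unfold incrBound
  positivity

theorem IsAdmissible.abs_estS_le (h : IsAdmissible M d ηv ηs ημ) {g : κ → ℝ}
    (hg : g ∈ (estS d z).law.support) (k : κ) : |g k| ≤ Fintype.card κ * maxEntry d := by
  have h1 := bounds_of_mem_support_estS h.d_bounds hg k
  have hK : (1 : ℝ) ≤ Fintype.card κ := by exact_mod_cast Fintype.card_pos
  have h2 : 1 ≤ Fintype.card κ * maxEntry d := one_le_mul_of_one_le_of_one_le hK h.one_le_maxEntry
  rw [abs_le]
  constructor <;> linarith

theorem signedPairing_sub_left (g g' u : Point S A κ) :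
    signedPairing (g - g') u = signedPairing g u - signedPairing g' u := by
  simp only [signedPairing, Prod.fst_sub, Prod.snd_sub, sub_dotProduct]
  ring

theorem signedPairing_add_left (g g' u : Point S A κ) :
    signedPairing (g + g') u = signedPairing g u + signedPairing g' u := by
  simp only [signedPairing, Prod.fst_add, Prod.snd_add, add_dotProduct]
  ring

/-- The regret of one iteration. -/
theorem next_spec (h : IsAdmissible M d ηv ηs ημ)
    (hz : IsIterate (2 * maxEntry d * M.mixTime) z) (hg : g ∈ (oracle M d z).support) :
    IsIterate (2 * maxEntry d * M.mixTime) (next M d ηv ηs ημ z g) ∧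
    ∀ u ∈ comparators M d, signedPairing (grad M d z) z - signedPairing (grad M d z) u ≤
      weightedDiv ηv ηs ημ z u - weightedDiv ηv ηs ημ (next M d ηv ηs ημ z g) u + ηv +
        stepError M d ηs ημ z g - signedPairing (grad M d z - g) u := by
  obtain ⟨hgv, hgs, hgμ⟩ := mem_support_of_mem_support_oracle hg
  have hD := h.one_le_maxEntry
  have ht := h.one_le_mixTime
  have hv := h.ηv_pos
  have hs := h.ηs_pos
  have hμ := h.ημ_pos
  have hb : 0 ≤ 2 * maxEntry d * M.mixTime := by positivity
  obtain ⟨v_mem, v_step⟩ := box_step (y := z.1) (G := ηv • g.1) hb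
    (y' := (next M d ηv ηs ημ z g).1) rfl
  obtain ⟨s_mem, s_pos, s_step⟩ := sDomain_step (y := z.2.1) (G := ηs • g.2.1) hz.s_pos
    (fun k => by
      have h1 := h.abs_estS_le hgs k
      have h2 := h.ηs_le
      have h3 : ηs * |g.2.1 k| ≤ ηs * (Fintype.card κ * maxEntry d) := by gcongr
      have h4 : 0 ≤ ηs * (Fintype.card κ * maxEntry d) := by positivity
      rw [Pi.smul_apply, smul_eq_mul, abs_mul, abs_of_pos hs]
      linarith) (y' := (next M d ηv ηs ημ z g).2.1) rfl
  -- The ascent step is a descent step for the negated gradient.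
  obtain ⟨μ_mem, μ_pos, μ_step⟩ := stdSimplex_step (y := z.2.2) (G := -(ημ • g.2.2)) hz.μ_mem
    hz.μ_pos (fun x => by
      have h1 : |g.2.2 x| ≤ Fintype.card (Σ i, A i) * incrBound M d :=
        abs_le_of_mem_support_estMu hz h.d_bounds hgμ x
      have h2 := h.ημ_le
      have h3 : ημ * |g.2.2 x| ≤ ημ * (Fintype.card (Σ i, A i) * incrBound M d) := by gcongr
      have h4 : 0 ≤ ημ * (Fintype.card (Σ i, A i) * incrBound M d) := by
        have := h.incrBound_pos
        positivity
      rw [Pi.neg_apply, abs_neg, Pi.smul_apply, smul_eq_mul, abs_mul, abs_of_pos hμ]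
      linarith) (y' := (next M d ηv ηs ημ z g).2.2) (by simp only [next, neg_dotProduct])
  refine ⟨⟨v_mem, s_mem, s_pos, μ_mem, μ_pos⟩, fun u hu => ?_⟩
  obtain ⟨huv, hus, huμ⟩ := hu
  have hv' := v_step u.1 huv
  have hs' := s_step u.2.1 hus
  have hμ' := μ_step u.2.2 huμ
  set z' := next M d ηv ηs ημ z g
  simp only [neg_dotProduct, smul_dotProduct, smul_eq_mul, Pi.smul_apply, Pi.neg_apply, neg_sq,
    mul_pow] at hv' hs' hμ'
  have e1 : dotProduct g.1 z.1 - dotProduct g.1 u.1 ≤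
      1 / ηv * euclidDiv z.1 u.1 - 1 / ηv * euclidDiv z'.1 u.1 + ηv := by
    -- `‖e_i - e_j‖² ≤ 2`, so the quadratic term `½ ηv² ‖g‖²` is at most `ηv²`.
    have h2 := sum_sq_le_of_mem_support_estV hgv
    rw [← Finset.mul_sum] at hv'
    have h3 : ηv ^ 2 * ∑ i, g.1 i ^ 2 ≤ ηv ^ 2 * 2 := by gcongr
    have h4 : ηv * (dotProduct g.1 z.1 - dotProduct g.1 u.1) ≤
        ηv * (1 / ηv * euclidDiv z.1 u.1 - 1 / ηv * euclidDiv z'.1 u.1 + ηv) := by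
      have : ηv * (1 / ηv * euclidDiv z.1 u.1 - 1 / ηv * euclidDiv z'.1 u.1 + ηv) =
          euclidDiv z.1 u.1 - euclidDiv z'.1 u.1 + ηv ^ 2 := by field_simp
      rw [this]
      linarith
    exact le_of_mul_le_mul_left h4 hv
  have e2 : dotProduct g.2.1 z.2.1 - dotProduct g.2.1 u.2.1 ≤
      1 / ηs * rescaledKlDiv z.2.1 u.2.1 - 1 / ηs * rescaledKlDiv z'.2.1 u.2.1 +
        ηs * ∑ k, z.2.1 k * g.2.1 k ^ 2 := by
    simp_rw [mul_left_comm _ (ηs ^ 2)] at hs'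
    rw [← Finset.mul_sum] at hs'
    refine le_of_mul_le_mul_left ?_ hs
    have : ηs * (1 / ηs * rescaledKlDiv z.2.1 u.2.1 - 1 / ηs * rescaledKlDiv z'.2.1 u.2.1 +
        ηs * ∑ k, z.2.1 k * g.2.1 k ^ 2) = rescaledKlDiv z.2.1 u.2.1 -
          rescaledKlDiv z'.2.1 u.2.1 + ηs ^ 2 * ∑ k, z.2.1 k * g.2.1 k ^ 2 := by field_simp
    rw [this]
    linarith
  have e3 : dotProduct g.2.2 u.2.2 - dotProduct g.2.2 z.2.2 ≤
      1 / ημ * rescaledKlDiv z.2.2 u.2.2 - 1 / ημ * rescaledKlDiv z'.2.2 u.2.2 +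
        ημ * ∑ x, z.2.2 x * g.2.2 x ^ 2 := by
    simp_rw [mul_left_comm _ (ημ ^ 2)] at hμ'
    rw [← Finset.mul_sum] at hμ'
    refine le_of_mul_le_mul_left ?_ hμ
    have : ημ * (1 / ημ * rescaledKlDiv z.2.2 u.2.2 - 1 / ημ * rescaledKlDiv z'.2.2 u.2.2 +
        ημ * ∑ x, z.2.2 x * g.2.2 x ^ 2) = rescaledKlDiv z.2.2 u.2.2 -
          rescaledKlDiv z'.2.2 u.2.2 + ημ ^ 2 * ∑ x, z.2.2 x * g.2.2 x ^ 2 := by field_simp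
    rw [this]
    linarith
  have e4 : signedPairing g z - signedPairing g u = dotProduct g.1 z.1 - dotProduct g.1 u.1 +
      (dotProduct g.2.1 z.2.1 - dotProduct g.2.1 u.2.1) +
      (dotProduct g.2.2 u.2.2 - dotProduct g.2.2 z.2.2) := by
    unfold signedPairing
    ring
  rw [stepError, signedPairing_sub_left, signedPairing_sub_left]
  unfold weightedDiv
  linarith

/-- The regret of one iteration is a difference of two values of the objective. -/
theorem objective_sub_objective (M : AMDP S A) (d : Matrix (Σ i, A i) κ ℝ) (z u : Point S A κ) :
    objective M d z.1 z.2.1 u.2.2 - objective M d u.1 u.2.1 z.2.2 =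
      signedPairing (grad M d z) z - signedPairing (grad M d z) u := by
  have h1 : ∀ w : S → ℝ, dotProduct ((AMDP.hatI A - M.P).transpose.mulVec z.2.2) w =
      dotProduct z.2.2 ((AMDP.hatI A - M.P).mulVec w) := fun w => by
    rw [Matrix.mulVec_transpose, Matrix.dotProduct_mulVec]
  have h2 : ∀ w : κ → ℝ, dotProduct (d.transpose.mulVec z.2.2) w =
      dotProduct z.2.2 (d.mulVec w) := fun w => by
    rw [Matrix.mulVec_transpose, Matrix.dotProduct_mulVec]
  have h3 : ∀ w : κ → ℝ, dotProduct (1 : κ → ℝ) w = ∑ k, w k := fun w => one_dotProduct w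
  simp only [objective, signedPairing, grad, sub_dotProduct, add_dotProduct, h1, h2, h3,
    dotProduct_add]
  rw [dotProduct_comm u.2.2 ((AMDP.hatI A - M.P).mulVec z.1), dotProduct_comm u.2.2 (d.mulVec _),
    dotProduct_comm z.2.2 ((AMDP.hatI A - M.P).mulVec z.1),
    dotProduct_comm z.2.2 (d.mulVec z.2.1)]
  ring

/-- The state of a run, with the quantities that its analysis accumulates: the current iterate, the
sum of the earlier iterates, the comparator-free part of the regret and the sum of the deviations
of the gradient estimates. -/
structure Trace (S : Type u) (A : S → Type v) (κ : Type w) where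
  pt : Point S A κ
  total : Point S A κ
  err : ℝ
  noise : Point S A κ

/-- The state after one more iteration, with gradient estimates `g`. -/
def Trace.step (M : AMDP S A) (d : Matrix (Σ i, A i) κ ℝ) (ηv ηs ημ : ℝ) (τ : Trace S A κ)
    (g : Point S A κ) : Trace S A κ where
  pt := next M d ηv ηs ημ τ.pt g
  total := τ.total + τ.pt
  err := τ.err + stepError M d ηs ημ τ.pt g
  noise := τ.noise + (grad M d τ.pt - g)

/-- The law of the state after `n` iterations started at `z₁`. -/
def trace (M : AMDP S A) (d : Matrix (Σ i, A i) κ ℝ) (ηv ηs ημ : ℝ) (z₁ : Point S A κ) :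
    ℕ → PMF (Trace S A κ)
  | 0 => PMF.pure ⟨z₁, 0, 0, 0⟩
  | n + 1 => (trace M d ηv ηs ημ z₁ n).bind fun τ =>
      (oracle M d τ.pt).map (τ.step M d ηv ηs ημ)

theorem finite_support_trace (M : AMDP S A) (d : Matrix (Σ i, A i) κ ℝ) (ηv ηs ημ : ℝ)
    (z₁ : Point S A κ) (n : ℕ) : (trace M d ηv ηs ημ z₁ n).support.Finite := by
  induction n with
  | zero => exact finite_support_pure _
  | succ n ih =>
    exact finite_support_bind ih fun τ _ => finite_support_map _ (finite_support_oracle M d τ.pt)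

theorem law_smdLoop (M : AMDP S A) (d : Matrix (Σ i, A i) κ ℝ) (ηv ηs ημ : ℝ)
    (z₁ : Point S A κ) (n : ℕ) :
    (smdLoop M d ηv ηs ημ z₁ n).law =
      (trace M d ηv ηs ημ z₁ n).map fun τ => (τ.pt, τ.total + τ.pt) := by
  induction n with
  | zero => simp [smdLoop, trace, Sampling.law_ret, PMF.pure_map]
  | succ n ih =>
    simp only [smdLoop, trace, Sampling.law_bind, Sampling.law_ret, ih, law_smdStep, PMF.bind_map,
      PMF.map_bind, PMF.map_comp]
    congr 1

/-- The loop sums the starting point and its `n` successors, whereas `Trace.total` omits the current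
point. The two sums agree after one further trace step, whose new iterate is discarded. -/
theorem law_smdLoop_snd (M : AMDP S A) (d : Matrix (Σ i, A i) κ ℝ) (ηv ηs ημ : ℝ)
    (z₁ : Point S A κ) (n : ℕ) :
    (smdLoop M d ηv ηs ημ z₁ n).law.map Prod.snd =
      (trace M d ηv ηs ημ z₁ (n + 1)).map Trace.total := by
  rw [law_smdLoop, PMF.map_comp, trace, PMF.map_bind, ← PMF.bind_pure_comp]
  congr 1
  funext τ
  rw [PMF.map_comp]
  exact (PMF.map_const _ _).symm

theorem mean_trace_succ (M : AMDP S A) (d : Matrix (Σ i, A i) κ ℝ) (ηv ηs ημ : ℝ)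
    (z₁ : Point S A κ) (n : ℕ) (f : Trace S A κ → ℝ) :
    mean (trace M d ηv ηs ημ z₁ (n + 1)) f = mean (trace M d ηv ηs ημ z₁ n) fun τ =>
      mean (oracle M d τ.pt) fun g => f (τ.step M d ηv ηs ημ g) := by
  rw [trace, mean_bind (finite_support_trace M d ηv ηs ημ z₁ n) fun τ _ =>
    finite_support_map _ (finite_support_oracle M d τ.pt)]
  congr 1
  funext τ
  rw [mean_map (finite_support_oracle M d τ.pt)]

/-- What holds surely after `n` iterations. -/
structure Trace.Invariant (M : AMDP S A) (d : Matrix (Σ i, A i) κ ℝ) (ηv ηs ημ : ℝ)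
    (z₁ : Point S A κ) (n : ℕ) (τ : Trace S A κ) : Prop where
  isIterate : IsIterate (2 * maxEntry d * M.mixTime) τ.pt
  abs_total_v : ∀ i, |τ.total.1 i| ≤ n * (2 * maxEntry d * M.mixTime)
  total_s_nonneg : ∀ k, 0 ≤ τ.total.2.1 k
  sum_total_s : ∑ k, τ.total.2.1 k ≤ n * 2
  total_μ_nonneg : ∀ x, 0 ≤ τ.total.2.2 x
  sum_total_μ : ∑ x, τ.total.2.2 x = n
  regret : ∀ u ∈ comparators M d,
    objective M d τ.total.1 τ.total.2.1 u.2.2 -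
      (dotProduct τ.total.2.2 ((AMDP.hatI A - M.P).mulVec u.1 + d.mulVec u.2.1) -
        n * ∑ k, u.2.1 k) + weightedDiv ηv ηs ημ τ.pt u ≤
      weightedDiv ηv ηs ημ z₁ u + n * ηv + τ.err - signedPairing τ.noise u

/-- Summation of the one-step regret: the divergences telescope, while the mean-zero pairing with
the iterate goes into `err` and the noise that meets the comparator goes into `noise`. -/
theorem invariant_of_mem_support_trace (h : IsAdmissible M d ηv ηs ημ) {z₁ : Point S A κ}
    (hz₁ : IsIterate (2 * maxEntry d * M.mixTime) z₁) (n : ℕ) :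
    ∀ τ ∈ (trace M d ηv ηs ημ z₁ n).support, τ.Invariant M d ηv ηs ημ z₁ n := by
  induction n with
  | zero =>
    intro τ hτ
    rw [trace, PMF.support_pure, Set.mem_singleton_iff] at hτ
    subst hτ
    refine ⟨hz₁, by simp, by simp, by simp, by simp, by simp, fun u _ => ?_⟩
    simp [objective, signedPairing]
  | succ n ih =>
    intro τ hτ
    rw [trace, PMF.mem_support_bind_iff] at hτ
    obtain ⟨τ, hτ', hg⟩ := hτ
    rw [PMF.support_map] at hg
    obtain ⟨g, hg, rfl⟩ := hg
    have hi := ih τ hτ'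
    obtain ⟨h1, h2⟩ := next_spec h hi.isIterate hg
    refine ⟨h1, fun i => ?_, fun k => ?_, ?_, fun x => ?_, ?_, fun u hu => ?_⟩
    · have := abs_add_le (τ.total.1 i) (τ.pt.1 i)
      have := hi.abs_total_v i
      have := hi.isIterate.v_mem i
      simp only [Trace.step, Prod.fst_add, Pi.add_apply]
      push_cast
      linarith
    · exact add_nonneg (hi.total_s_nonneg k) (hi.isIterate.s_pos k).le
    · have := hi.sum_total_s
      have := hi.isIterate.s_mem.2
      simp only [Trace.step, Prod.snd_add, Prod.fst_add, Pi.add_apply, Finset.sum_add_distrib]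
      push_cast
      linarith
    · exact add_nonneg (hi.total_μ_nonneg x) (hi.isIterate.μ_pos x).le
    · simp only [Trace.step, Prod.snd_add, Pi.add_apply, Finset.sum_add_distrib,
        hi.sum_total_μ, hi.isIterate.μ_mem.2]
      push_cast
      rfl
    · have h3 := h2 u hu
      have h4 := hi.regret u hu
      -- As values of the objective the one-step terms add up to terms in the total point. Only `1ᵀ
      -- s` of the comparator is not scaled by the sum of the `μ_t`, hence the factor `n`.
      rw [← objective_sub_objective] at h3
      simp only [Trace.step, signedPairing_add_left]
      simp only [objective, Prod.fst_add, Prod.snd_add, Matrix.mulVec_add, dotProduct_add,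
        add_dotProduct, Pi.add_apply, Finset.sum_add_distrib] at h3 h4 ⊢
      push_cast
      linarith

/-! ### Moments of the accumulated quantities -/

/-- Unbiasedness of the three estimates. The point `u` is fixed before the draw; this covers the
current iterate but not the maximizing comparator. -/
theorem mean_signedPairing_oracle {b : ℝ} (hz : IsIterate b z) (u : Point S A κ) :
    mean (oracle M d z) (fun g => signedPairing (grad M d z - g) u) = 0 := by
  have hf := finite_support_oracle M d z
  have h1 : mean (oracle M d z) (fun g => dotProduct g.1 u.1) =
      dotProduct (grad M d z).1 u.1 := by
    simp only [dotProduct]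
    rw [mean_sum hf]
    refine Finset.sum_congr rfl fun i _ => ?_
    simp_rw [mul_comm _ (u.1 i)]
    rw [mean_const_mul, mean_oracle_v (fun g => g i), mean_estV_apply (d := d) hz]
  have h2 : mean (oracle M d z) (fun g => dotProduct g.2.1 u.2.1) =
      dotProduct (grad M d z).2.1 u.2.1 := by
    simp only [dotProduct]
    rw [mean_sum hf]
    refine Finset.sum_congr rfl fun i _ => ?_
    simp_rw [mul_comm _ (u.2.1 i)]
    rw [mean_const_mul, mean_oracle_s (fun g => g i), mean_estS_apply (M := M) hz]
  have h3 : mean (oracle M d z) (fun g => dotProduct g.2.2 u.2.2) =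
      dotProduct (grad M d z).2.2 u.2.2 := by
    simp only [dotProduct]
    rw [mean_sum hf]
    refine Finset.sum_congr rfl fun i _ => ?_
    simp_rw [mul_comm _ (u.2.2 i)]
    rw [mean_const_mul, mean_oracle_μ (fun g => g i), mean_estMu_apply hz]
  simp_rw [signedPairing_sub_left]
  rw [mean_sub hf, mean_const]
  simp only [signedPairing]
  rw [mean_sub hf, mean_add hf, h1, h2, h3]
  ring

theorem mean_stepError_le (h : IsAdmissible M d ηv ηs ημ)
    (hz : IsIterate (2 * maxEntry d * M.mixTime) z) :
    mean (oracle M d z) (stepError M d ηs ημ z) ≤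
      ηs * (4 * (Fintype.card κ * maxEntry d ^ 2)) +
        ημ * (Fintype.card (Σ i, A i) * incrBound M d ^ 2) := by
  have hf := finite_support_oracle M d z
  have hD := h.one_le_maxEntry
  have hK : (1 : ℝ) ≤ Fintype.card κ := by exact_mod_cast Fintype.card_pos
  have hKD : 1 ≤ Fintype.card κ * maxEntry d ^ 2 :=
    one_le_mul_of_one_le_of_one_le hK (one_le_pow₀ hD)
  have hs : ∀ k, mean (estS d z).law (fun g => g k ^ 2) ≤
      2 * (Fintype.card κ * maxEntry d ^ 2) := by
    intro k
    calc mean (estS d z).law (fun g => g k ^ 2)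
        ≤ mean (estS d z).law (fun g => (g k - (-1)) ^ 2 + 1) := by
          refine mean_le_mean (finite_support_estS d z) fun g hg => ?_
          -- `g² ≤ (g + 1)² + 1` because `g ≥ -1`; the extra 1 is absorbed by `K D² ≥ 1`.
          nlinarith [(bounds_of_mem_support_estS h.d_bounds hg k).1]
      _ ≤ Fintype.card κ * maxEntry d ^ 2 + 1 := by
          rw [mean_add (finite_support_estS d z), mean_const]
          gcongr
          exact mean_sq_estS_le hz h.d_bounds k
      _ ≤ _ := by linarith
  have h1 : mean (oracle M d z) (fun g => ∑ k, z.2.1 k * g.2.1 k ^ 2) ≤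
      4 * (Fintype.card κ * maxEntry d ^ 2) := by
    rw [mean_sum hf]
    calc _ ≤ ∑ k, z.2.1 k * (2 * (Fintype.card κ * maxEntry d ^ 2)) := by
          refine Finset.sum_le_sum fun k _ => ?_
          rw [mean_const_mul, mean_oracle_s (fun g => g k ^ 2)]
          exact mul_le_mul_of_nonneg_left (hs k) (hz.s_pos k).le
      _ ≤ _ := by
          rw [← Finset.sum_mul]
          nlinarith [hz.s_mem.2]
  have h2 : mean (oracle M d z) (fun g => ∑ x, z.2.2 x * g.2.2 x ^ 2) ≤
      Fintype.card (Σ i, A i) * incrBound M d ^ 2 := by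
    rw [mean_sum hf]
    calc _ ≤ ∑ x, z.2.2 x * (Fintype.card (Σ i, A i) * incrBound M d ^ 2) := by
          refine Finset.sum_le_sum fun x _ => ?_
          rw [mean_const_mul, mean_oracle_μ (fun g => g x ^ 2)]
          exact mul_le_mul_of_nonneg_left (mean_sq_estMu_le hz h.d_bounds x) (hz.μ_pos x).le
      _ = _ := by rw [← Finset.sum_mul, hz.μ_mem.2, one_mul]
  unfold stepError
  rw [mean_add hf, mean_add hf, mean_const_mul, mean_const_mul, mean_signedPairing_oracle hz]
  have := h.ηs_pos
  have := h.ημ_pos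
  rw [zero_add]
  gcongr

variable {z₁ : Point S A κ}

theorem mean_err_le (h : IsAdmissible M d ηv ηs ημ)
    (hz₁ : IsIterate (2 * maxEntry d * M.mixTime) z₁) (n : ℕ) :
    mean (trace M d ηv ηs ημ z₁ n) Trace.err ≤
      n * (ηs * (4 * (Fintype.card κ * maxEntry d ^ 2)) +
        ημ * (Fintype.card (Σ i, A i) * incrBound M d ^ 2)) := by
  induction n with
  | zero => simp [trace, mean_pure]
  | succ n ih =>
    have hf := finite_support_trace M d ηv ηs ημ z₁ n
    rw [mean_trace_succ]
    calc _ ≤ mean (trace M d ηv ηs ημ z₁ n) fun τ => τ.err +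
          (ηs * (4 * (Fintype.card κ * maxEntry d ^ 2)) +
            ημ * (Fintype.card (Σ i, A i) * incrBound M d ^ 2)) := by
          refine mean_le_mean hf fun τ hτ => ?_
          simp only [Trace.step]
          rw [mean_add (finite_support_oracle M d τ.pt), mean_const]
          gcongr
          exact mean_stepError_le h (invariant_of_mem_support_trace h hz₁ n τ hτ).isIterate
      _ ≤ _ := by
          rw [mean_add hf, mean_const]
          push_cast
          linarith

/-- Martingale orthogonality: the cross term with the past noise has conditional mean zero, and each
new deviation adds at most `E ‖g‖² ≤ 2`. -/
theorem mean_sum_sq_noise_le (h : IsAdmissible M d ηv ηs ημ)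
    (hz₁ : IsIterate (2 * maxEntry d * M.mixTime) z₁) (n : ℕ) :
    mean (trace M d ηv ηs ημ z₁ n) (fun τ => ∑ i, τ.noise.1 i ^ 2) ≤ n * 2 := by
  induction n with
  | zero => simp [trace, mean_pure]
  | succ n ih =>
    have hf := finite_support_trace M d ηv ηs ημ z₁ n
    rw [mean_trace_succ]
    calc _ ≤ mean (trace M d ηv ηs ημ z₁ n) fun τ => ∑ i, τ.noise.1 i ^ 2 + 2 := by
          refine mean_le_mean hf fun τ hτ => ?_
          have hz := (invariant_of_mem_support_trace h hz₁ n τ hτ).isIterate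
          have hV := finite_support_estV M τ.pt
          simp only [Trace.step, Prod.fst_add, Prod.fst_sub, Pi.add_apply, Pi.sub_apply]
          rw [mean_oracle_v (fun g =>
            ∑ i, (τ.noise.1 i + ((grad M d τ.pt).1 i - g i)) ^ 2), mean_sum hV]
          have key : ∀ i, mean (estV M τ.pt).law
              (fun g => (τ.noise.1 i + ((grad M d τ.pt).1 i - g i)) ^ 2) ≤
              τ.noise.1 i ^ 2 + mean (estV M τ.pt).law (fun g => g i ^ 2) := by
            intro i
            have h1 := mean_sq_mean_sub_le hV (fun g => g i) 0
            have h2 := mean_mean_sub hV (fun g => g i)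
            rw [mean_estV_apply (d := d) hz] at h1 h2
            simp only [sub_zero] at h1
            have h3 : (fun g : S → ℝ => (τ.noise.1 i + ((grad M d τ.pt).1 i - g i)) ^ 2) =
                fun g => (τ.noise.1 i ^ 2 + (2 * τ.noise.1 i) * ((grad M d τ.pt).1 i - g i)) +
                  ((grad M d τ.pt).1 i - g i) ^ 2 := by
              funext g
              ring
            rw [h3, mean_add hV, mean_add hV, mean_const, mean_const_mul, h2]
            linarith
          refine (Finset.sum_le_sum fun i _ => key i).trans ?_
          rw [Finset.sum_add_distrib, ← mean_sum hV]
          gcongr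
          exact mean_le_of_forall_le hV fun g hg => sum_sq_le_of_mem_support_estV hg
      _ ≤ _ := by
          rw [mean_add hf, mean_const]
          push_cast
          linarith

/-- Conditionally on the past, one more draw multiplies the exponential moment by at most `exp(ηs² K
D²)`. -/
theorem mean_exp_noise_s_le (h : IsAdmissible M d ηv ηs ημ)
    (hz₁ : IsIterate (2 * maxEntry d * M.mixTime) z₁) (k : κ) (n : ℕ) :
    mean (trace M d ηv ηs ημ z₁ n) (fun τ => Real.exp (-(ηs * τ.noise.2.1 k))) ≤
      Real.exp (n * (ηs ^ 2 * (Fintype.card κ * maxEntry d ^ 2))) := by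
  induction n with
  | zero => simp [trace, mean_pure]
  | succ n ih =>
    have hf := finite_support_trace M d ηv ηs ημ z₁ n
    rw [mean_trace_succ]
    calc _ ≤ mean (trace M d ηv ηs ημ z₁ n) fun τ =>
          Real.exp (ηs ^ 2 * (Fintype.card κ * maxEntry d ^ 2)) *
            Real.exp (-(ηs * τ.noise.2.1 k)) := by
          refine mean_le_mean hf fun τ hτ => ?_
          have hz := (invariant_of_mem_support_trace h hz₁ n τ hτ).isIterate
          have hV := finite_support_estS d τ.pt
          simp only [Trace.step, Prod.fst_add, Prod.snd_add, Prod.fst_sub, Prod.snd_sub,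
            Pi.add_apply, Pi.sub_apply]
          rw [mean_oracle_s (fun g => Real.exp (-(ηs *
            (τ.noise.2.1 k + ((grad M d τ.pt).2.1 k - g k)))))]
          have h1 := mean_exp_mean_sub_le hV (X := fun g => g k) (l := -ηs)
            (fun g hg => ?_) (mean_sq_estS_le hz h.d_bounds k)
          · rw [mean_estS_apply (M := M) hz, neg_sq] at h1
            have h2 : (fun g : κ → ℝ => Real.exp (-(ηs *
                (τ.noise.2.1 k + ((grad M d τ.pt).2.1 k - g k))))) = fun g =>
                Real.exp (-(ηs * τ.noise.2.1 k)) *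
                  Real.exp (-ηs * ((grad M d τ.pt).2.1 k - g k)) := by
              funext g
              rw [← Real.exp_add]
              ring_nf
            rw [h2, mean_const_mul, mul_comm]
            gcongr
          · have h3 : mean (estS d τ.pt).law (fun g => g k) ≤ Fintype.card κ * maxEntry d :=
              mean_le_of_forall_le hV fun g hg => (abs_le.1 (h.abs_estS_le hg k)).2
            have h4 : -(Fintype.card κ * maxEntry d) ≤ mean (estS d τ.pt).law (fun g => g k) := by
              rw [← mean_const (estS d τ.pt).law (-(Fintype.card κ * maxEntry d))]
              exact mean_le_mean hV fun g hg => (abs_le.1 (h.abs_estS_le hg k)).1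
            have h5 := abs_le.1 (h.abs_estS_le hg k)
            -- The factor 2 in `ηs_le` is used here: a centered estimate can be twice as large as
            -- the estimate itself.
            rw [abs_mul, abs_neg, abs_of_pos h.ηs_pos]
            refine le_trans ?_ h.ηs_le
            have := h.ηs_pos
            gcongr
            rw [abs_le]
            constructor <;> linarith
      _ ≤ _ := by
          rw [mean_const_mul]
          push_cast
          rw [add_mul, one_mul, Real.exp_add, mul_comm]
          gcongr

theorem mean_exp_noise_μ_le (h : IsAdmissible M d ηv ηs ημ)
    (hz₁ : IsIterate (2 * maxEntry d * M.mixTime) z₁) (x : Σ i, A i) (n : ℕ) :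
    mean (trace M d ηv ηs ημ z₁ n) (fun τ => Real.exp (ημ * τ.noise.2.2 x)) ≤
      Real.exp (n * (ημ ^ 2 * (Fintype.card (Σ i, A i) * incrBound M d ^ 2))) := by
  induction n with
  | zero => simp [trace, mean_pure]
  | succ n ih =>
    have hf := finite_support_trace M d ηv ηs ημ z₁ n
    rw [mean_trace_succ]
    calc _ ≤ mean (trace M d ηv ηs ημ z₁ n) fun τ =>
          Real.exp (ημ ^ 2 * (Fintype.card (Σ i, A i) * incrBound M d ^ 2)) *
            Real.exp (ημ * τ.noise.2.2 x) := by
          refine mean_le_mean hf fun τ hτ => ?_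
          have hz := (invariant_of_mem_support_trace h hz₁ n τ hτ).isIterate
          have hV := finite_support_estMu M d τ.pt
          have hab : ∀ g ∈ (estMu M d τ.pt).law.support,
              |g x| ≤ Fintype.card (Σ i, A i) * incrBound M d :=
            fun g hg => abs_le_of_mem_support_estMu hz h.d_bounds hg x
          simp only [Trace.step, Prod.snd_add, Prod.snd_sub, Pi.add_apply, Pi.sub_apply]
          rw [mean_oracle_μ (fun g => Real.exp (ημ *
            (τ.noise.2.2 x + ((grad M d τ.pt).2.2 x - g x))))]
          have h1 := mean_exp_mean_sub_le hV (X := fun g => g x) (l := ημ) (c := 0)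
            (σ := Fintype.card (Σ i, A i) * incrBound M d ^ 2)
            (fun g hg => ?_) (by simpa only [sub_zero, incrBound] using mean_sq_estMu_le hz h.d_bounds x)
          · rw [mean_estMu_apply hz] at h1
            have h2 : (fun g : (Σ i, A i) → ℝ => Real.exp (ημ *
                (τ.noise.2.2 x + ((grad M d τ.pt).2.2 x - g x)))) = fun g =>
                Real.exp (ημ * τ.noise.2.2 x) *
                  Real.exp (ημ * ((grad M d τ.pt).2.2 x - g x)) := by
              funext g
              rw [← Real.exp_add]
              ring_nf
            rw [h2, mean_const_mul, mul_comm]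
            gcongr
          · have h3 : mean (estMu M d τ.pt).law (fun g => g x) ≤
                Fintype.card (Σ i, A i) * incrBound M d :=
              mean_le_of_forall_le hV fun g hg => (abs_le.1 (hab g hg)).2
            have h4 : -(Fintype.card (Σ i, A i) * incrBound M d) ≤
                mean (estMu M d τ.pt).law (fun g => g x) := by
              rw [← mean_const (estMu M d τ.pt).law (-(Fintype.card (Σ i, A i) * incrBound M d))]
              exact mean_le_mean hV fun g hg => (abs_le.1 (hab g hg)).1
            have h5 := abs_le.1 (hab g hg)
            rw [abs_mul, abs_of_pos h.ημ_pos]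
            refine le_trans ?_ h.ημ_le
            have := h.ημ_pos
            gcongr
            rw [abs_le]
            constructor <;> linarith
      _ ≤ _ := by
          rw [mean_const_mul]
          push_cast
          rw [add_mul, one_mul, Real.exp_add, mul_comm]
          gcongr

end Trace

/-! ## The expected duality gap -/

section Gap

set_option linter.unusedSectionVars false

variable {S : Type u} {A : S → Type v} {κ : Type w}
  [Fintype S] [DecidableEq S] [∀ i, Fintype (A i)] [∀ i, DecidableEq (A i)]
  [Fintype κ] [DecidableEq κ] [Nonempty S] [∀ i, Nonempty (A i)] [Nonempty κ]

/-- Every time in `mixedTimes` is at least 1, and a deterministic policy shows that the supremum is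
not over the empty set. -/
theorem one_le_mixTime {M : AMDP S A} (hM : M.IsMixing) : 1 ≤ M.mixTime := by
  have h : 1 ≤ M.tmix :=
    le_iSup_of_le (fun i => ⟨Pi.single (Classical.arbitrary (A i)) 1, single_mem_stdSimplex ℝ _⟩)
      (le_iInf₂ fun t ht => by exact_mod_cast ht.1)
  rw [← ENat.natCast_toNat hM] at h
  unfold AMDP.mixTime
  exact_mod_cast h

/-- A constraint value `(dᵀ μ)_k ≥ 1` is an average of entries of `d`. -/
theorem one_le_maxEntry {M : AMDP S A} {d : Matrix (Σ i, A i) κ ℝ} (h : IsFeasible M d) :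
    1 ≤ maxEntry d := by
  obtain ⟨μ, hμ, -, hk⟩ := h
  refine (hk (Classical.arbitrary κ)).trans ?_
  calc ∑ x, d x (Classical.arbitrary κ) * μ x ≤ ∑ x, maxEntry d * μ x :=
        Finset.sum_le_sum fun x _ => mul_le_mul_of_nonneg_right (le_maxEntry d x _) (hμ.1 x)
    _ = maxEntry d := by rw [← Finset.mul_sum, hμ.2, mul_one]

/-- At a feasible occupancy measure the objective is nonnegative. -/
theorem exists_objective_nonneg {M : AMDP S A} {d : Matrix (Σ i, A i) κ ℝ} (h : IsFeasible M d) :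
    ∃ μ ∈ stdSimplex ℝ (Σ i, A i), ∀ (v : S → ℝ) (s : κ → ℝ), (∀ k, 0 ≤ s k) →
      0 ≤ objective M d v s μ := by
  obtain ⟨μ, hμ, h0, hk⟩ := h
  refine ⟨μ, hμ, fun v s hs => ?_⟩
  have h1 : dotProduct μ ((AMDP.hatI A - M.P).mulVec v) = 0 := by
    rw [Matrix.dotProduct_mulVec, ← Matrix.mulVec_transpose, h0, zero_dotProduct]
  have h2 : ∑ k, s k ≤ dotProduct μ (d.mulVec s) := by
    rw [Matrix.dotProduct_mulVec, ← Matrix.mulVec_transpose]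
    refine Finset.sum_le_sum fun k _ => ?_
    nlinarith [hk k, hs k]
  rw [objective, dotProduct_add, h1]
  linarith

/-- Doubling the box of the comparators at most doubles the duality gap. -/
theorem gap_le_two_mul {M : AMDP S A} {d : Matrix (Σ i, A i) κ ℝ} (h : IsFeasible M d)
    (hb : 0 ≤ 2 * maxEntry d * M.mixTime) {z : Point S A κ} (hz : ∀ k, 0 ≤ z.2.1 k) {c : ℝ}
    (hc : ∀ u ∈ comparators M d,
      objective M d z.1 z.2.1 u.2.2 - objective M d u.1 u.2.1 z.2.2 ≤ c) :
    gap M d z ≤ 2 * c := by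
  obtain ⟨μ, hμ, hμ0⟩ := exists_objective_nonneg h
  obtain ⟨v, s, ν⟩ := z
  simp only at hz hc
  have key : ∀ μ' ∈ stdSimplex ℝ (Σ i, A i), ∀ y ∈ primalDomain M d,
      objective M d v s μ' - objective M d y.1 y.2 ν ≤ 2 * c := by
    rintro μ' hμ' ⟨v', s'⟩ ⟨hv', hs'⟩
    have hbox : (1 / 2 : ℝ) • v' ∈ box S (2 * maxEntry d * M.mixTime) := fun i => by
      have := hv' i
      unfold boundM at this
      rw [Pi.smul_apply, smul_eq_mul, abs_mul, abs_of_pos (by norm_num)]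
      linarith
    -- The term in `v'` is linear, so two comparators with `v'/2` add up to the full one. The second
    -- has `s = 0` and the feasible `μ`, where the objective at `(v, s)` is nonnegative and can be
    -- dropped.
    have h1 := hc ((1 / 2 : ℝ) • v', s', μ') ⟨hbox, hs', hμ'⟩
    have h2 := hc ((1 / 2 : ℝ) • v', 0, μ) ⟨hbox, ⟨by simp, by simp⟩, hμ⟩
    have h3 := hμ0 v s hz
    simp only [objective, dotProduct_add, Matrix.mulVec_smul, dotProduct_smul, smul_eq_mul,
      Matrix.mulVec_zero, dotProduct_zero, Pi.zero_apply, Finset.sum_const_zero] at h1 h2 h3 ⊢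
    linarith
  have hne : (primalDomain M d).Nonempty :=
    ⟨0, fun i => by simpa [boundM] using hb, ⟨by simp, by simp⟩⟩
  have h1 : sSup ((fun μ' => objective M d v s μ') '' stdSimplex ℝ (Σ i, A i)) - 2 * c ≤
      sInf ((fun y : (S → ℝ) × (κ → ℝ) => objective M d y.1 y.2 ν) '' primalDomain M d) := by
    refine le_csInf (hne.image _) ?_
    rintro _ ⟨y, hy, rfl⟩
    have : sSup ((fun μ' => objective M d v s μ') '' stdSimplex ℝ (Σ i, A i)) ≤
        2 * c + objective M d y.1 y.2 ν := by
      refine csSup_le (Set.Nonempty.image _ ⟨μ, hμ⟩) ?_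
      rintro _ ⟨μ', hμ', rfl⟩
      linarith [key μ' hμ' y hy]
    simp only
    linarith
  rw [gap]
  linarith

/-- The divergence from the uniform vector. -/
theorem rescaledKlDiv_uniform_le {ι : Type*} [Fintype ι] [Nonempty ι] {u : ι → ℝ} {r : ℝ}
    (hu : ∀ i, 0 ≤ u i) (hur : ∀ i, u i ≤ r) :
    rescaledKlDiv (fun _ : ι => 1 / (Fintype.card ι : ℝ)) u ≤
      (∑ i, u i) * Real.log (r * Fintype.card ι) - ∑ i, u i + 1 := by
  have hn : (0 : ℝ) < Fintype.card ι := by exact_mod_cast Fintype.card_pos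
  have h : ∑ i, u i * Real.log (u i / (1 / (Fintype.card ι : ℝ))) ≤
      (∑ i, u i) * Real.log (r * Fintype.card ι) := by
    rw [Finset.sum_mul]
    refine Finset.sum_le_sum fun i _ => ?_
    rcases (hu i).eq_or_lt with h0 | h0
    · simp [← h0]
    · refine mul_le_mul_of_nonneg_left (Real.log_le_log (by positivity) ?_) (hu i)
      rw [div_div_eq_mul_div, div_one]
      have := hur i
      gcongr
  have hsum : ∑ _i : ι, 1 / (Fintype.card ι : ℝ) = 1 := by
    rw [Finset.sum_const, Finset.card_univ, nsmul_eq_mul, mul_one_div_cancel hn.ne']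
  unfold rescaledKlDiv
  beta_reduce
  rw [hsum]
  linarith

/-- The starting point of the algorithm. -/
def startPoint (A : S → Type v) [∀ i, Fintype (A i)] (κ : Type w) [Fintype κ] (v₁ : S → ℝ) :
    Point S A κ :=
  (v₁, fun _ => 1 / (Fintype.card κ : ℝ), fun _ => 1 / (Fintype.card (Σ i, A i) : ℝ))

theorem isIterate_startPoint {b : ℝ} {v₁ : S → ℝ} (hv₁ : v₁ ∈ box S b) :
    IsIterate b (startPoint A κ v₁) := by
  have hK : (0 : ℝ) < Fintype.card κ := by exact_mod_cast Fintype.card_pos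
  have hn : (0 : ℝ) < Fintype.card (Σ i, A i) := by exact_mod_cast Fintype.card_pos
  refine ⟨hv₁, ⟨fun k => ?_, ?_⟩, fun k => ?_, ⟨fun x => ?_, ?_⟩, fun x => ?_⟩ <;>
    simp only [startPoint]
  · positivity
  · rw [Finset.sum_const, Finset.card_univ, nsmul_eq_mul, mul_one_div_cancel hK.ne']
    norm_num
  · positivity
  · positivity
  · rw [Finset.sum_const, Finset.card_univ, nsmul_eq_mul, mul_one_div_cancel hn.ne']
  · positivity

variable {M : AMDP S A} {d : Matrix (Σ i, A i) κ ℝ} {ηv ηs ημ : ℝ} {v₁ : S → ℝ}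

/-- A bound on the regret after `n` iterations that is uniform in the comparator. -/
def regretBound (M : AMDP S A) (d : Matrix (Σ i, A i) κ ℝ) (ηv ηs ημ : ℝ) (n : ℕ)
    (τ : Trace S A κ) : ℝ :=
  1 / ηv * (5 / 2 * (Fintype.card S * (2 * maxEntry d * M.mixTime) ^ 2)) + n * ηv +
    ηv / 2 * ∑ i, τ.noise.1 i ^ 2 + τ.err +
    1 / ηs * (4 * Real.log (2 * Fintype.card κ) + 1 +
      2 * (n * (ηs ^ 2 * (Fintype.card κ * maxEntry d ^ 2))) +
      ∑ k, 1 / (Fintype.card κ : ℝ) * (Real.exp (-(n * (ηs ^ 2 *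
        (Fintype.card κ * maxEntry d ^ 2)))) * Real.exp (-(ηs * τ.noise.2.1 k)))) +
    1 / ημ * (2 * Real.log (Fintype.card (Σ i, A i)) - 1 +
      n * (ημ ^ 2 * (Fintype.card (Σ i, A i) * incrBound M d ^ 2)) +
      ∑ x, 1 / (Fintype.card (Σ i, A i) : ℝ) * (Real.exp (-(n * (ημ ^ 2 *
        (Fintype.card (Σ i, A i) * incrBound M d ^ 2)))) * Real.exp (ημ * τ.noise.2.2 x)))

/-- Coordinatewise, `½ (v - y)² ≤ 2 b²`, and Young's inequality gives `-η N y ≤ ½ b² + ½ η² N²`; the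
sum explains `5/2`. -/
theorem euclidDiv_sub_dotProduct_le {v y N : S → ℝ} {b η : ℝ} (hη : 0 < η) (hv : v ∈ box S b)
    (hy : y ∈ box S b) :
    1 / η * euclidDiv v y - dotProduct N y ≤
      1 / η * (5 / 2 * (Fintype.card S * b ^ 2)) + η / 2 * ∑ i, N i ^ 2 := by
  refine le_of_mul_le_mul_left ?_ hη
  have h1 : η * (1 / η * euclidDiv v y - dotProduct N y) = euclidDiv v y - η * dotProduct N y := by
    field_simp
  have h2 : η * (1 / η * (5 / 2 * (Fintype.card S * b ^ 2)) + η / 2 * ∑ i, N i ^ 2) =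
      Fintype.card S * (5 / 2 * b ^ 2) + η ^ 2 / 2 * ∑ i, N i ^ 2 := by
    field_simp
  rw [h1, h2, euclidDiv, dotProduct, ← nsmul_eq_mul, ← Finset.card_univ, ← Finset.sum_const,
    Finset.mul_sum, Finset.mul_sum, Finset.mul_sum, ← Finset.sum_sub_distrib,
    ← Finset.sum_add_distrib]
  refine Finset.sum_le_sum fun i _ => ?_
  have h3 : (v i - y i) ^ 2 ≤ (2 * b) ^ 2 := by
    have := abs_le.1 (hv i)
    have := abs_le.1 (hy i)
    refine sq_le_sq' ?_ ?_ <;> linarith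
  have h4 : y i ^ 2 ≤ b ^ 2 := by
    have := abs_le.1 (hy i)
    exact sq_le_sq' this.1 this.2
  nlinarith [sq_nonneg (η * N i + y i)]

/-- The Fenchel inequality at the uniform vector, with a uniform shift of the exponents. -/
theorem neg_dotProduct_le_uniform {ι : Type*} [Fintype ι] [Nonempty ι] {u : ι → ℝ}
    (hu : ∀ i, 0 ≤ u i) (G : ι → ℝ) (m : ℝ) :
    -dotProduct G u ≤ rescaledKlDiv (fun _ : ι => 1 / (Fintype.card ι : ℝ)) u + m * ∑ i, u i - 1 +
      ∑ i, 1 / (Fintype.card ι : ℝ) * (Real.exp (-m) * Real.exp (-G i)) := by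
  have hn : (0 : ℝ) < Fintype.card ι := by exact_mod_cast Fintype.card_pos
  have h := sub_sum_le_dotProduct_add_rescaledKlDiv (y := fun _ : ι => 1 / (Fintype.card ι : ℝ))
    (fun i => G i + m) (fun _ => by positivity) hu
  have hsum : ∑ _i : ι, 1 / (Fintype.card ι : ℝ) = 1 := by
    rw [Finset.sum_const, Finset.card_univ, nsmul_eq_mul, mul_one_div_cancel hn.ne']
  have h1 : dotProduct (fun i => G i + m) u = dotProduct G u + m * ∑ i, u i := by
    simp only [dotProduct, add_mul, Finset.sum_add_distrib, Finset.mul_sum]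
  have h2 : ∀ i, Real.exp (-(G i + m)) = Real.exp (-m) * Real.exp (-G i) := fun i => by
    rw [← Real.exp_add]
    ring_nf
  simp_rw [h2] at h
  rw [hsum, h1] at h
  linarith

/-- The divergence from the uniform vector is paid twice, once for the telescoped regret and once in
the Fenchel bound on the noise; hence the doubled logarithms in `regretBound`. -/
theorem Trace.Invariant.regret_le (h : IsAdmissible M d ηv ηs ημ)
    (hv₁ : v₁ ∈ box S (2 * maxEntry d * M.mixTime)) {n : ℕ} {τ : Trace S A κ}
    (hτ : τ.Invariant M d ηv ηs ημ (startPoint A κ v₁) n) {u : Point S A κ}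
    (hu : u ∈ comparators M d) :
    objective M d τ.total.1 τ.total.2.1 u.2.2 -
      (dotProduct τ.total.2.2 ((AMDP.hatI A - M.P).mulVec u.1 + d.mulVec u.2.1) -
        n * ∑ k, u.2.1 k) ≤ regretBound M d ηv ηs ημ n τ := by
  obtain ⟨huv, hus, huμ⟩ := id hu
  have hv := h.ηv_pos
  have hs := h.ηs_pos
  have hμ := h.ημ_pos
  have hK : (1 : ℝ) ≤ Fintype.card κ := by exact_mod_cast Fintype.card_pos
  have hw : 0 ≤ weightedDiv ηv ηs ημ τ.pt u := by
    have h1 := rescaledKlDiv_nonneg hτ.isIterate.s_pos hus.1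
    have h2 := rescaledKlDiv_nonneg hτ.isIterate.μ_pos huμ.1
    have h3 : 0 ≤ euclidDiv τ.pt.1 u.1 :=
      mul_nonneg (by norm_num) (Finset.sum_nonneg fun i _ => sq_nonneg _)
    unfold weightedDiv
    positivity
  have hreg := hτ.regret u hu
  have hV := euclidDiv_sub_dotProduct_le (N := τ.noise.1) hv hv₁ huv
  have hS : 1 / ηs * rescaledKlDiv (fun _ : κ => 1 / (Fintype.card κ : ℝ)) u.2.1 -
      dotProduct τ.noise.2.1 u.2.1 ≤
      1 / ηs * (4 * Real.log (2 * Fintype.card κ) + 1 +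
      2 * (n * (ηs ^ 2 * (Fintype.card κ * maxEntry d ^ 2))) +
      ∑ k, 1 / (Fintype.card κ : ℝ) * (Real.exp (-(n * (ηs ^ 2 *
        (Fintype.card κ * maxEntry d ^ 2)))) * Real.exp (-(ηs * τ.noise.2.1 k)))) := by
    -- The shift is the exponent in `mean_exp_noise_s_le`, so that the exponential average has
    -- expectation at most 1. It costs `m ∑ u ≤ 2m`.
    have h1 := neg_dotProduct_le_uniform hus.1 (ηs • τ.noise.2.1)
      (n * (ηs ^ 2 * (Fintype.card κ * maxEntry d ^ 2)))
    have hsum0 : 0 ≤ ∑ k, u.2.1 k := Finset.sum_nonneg fun k _ => hus.1 k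
    have h2 := rescaledKlDiv_uniform_le (r := 2) hus.1 fun k =>
      (Finset.single_le_sum (fun k _ => hus.1 k) (Finset.mem_univ k)).trans hus.2
    have hl : 0 ≤ Real.log (2 * Fintype.card κ) := Real.log_nonneg (by linarith)
    have h3 : (∑ k, u.2.1 k) * Real.log (2 * Fintype.card κ) ≤
        2 * Real.log (2 * Fintype.card κ) := mul_le_mul_of_nonneg_right hus.2 hl
    have h4 : n * (ηs ^ 2 * (Fintype.card κ * maxEntry d ^ 2)) * ∑ k, u.2.1 k ≤
        n * (ηs ^ 2 * (Fintype.card κ * maxEntry d ^ 2)) * 2 :=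
      mul_le_mul_of_nonneg_left hus.2 (by positivity)
    rw [smul_dotProduct, smul_eq_mul] at h1
    simp only [Pi.smul_apply, smul_eq_mul] at h1
    refine le_of_mul_le_mul_left ?_ hs
    rw [← mul_assoc ηs (1 / ηs), mul_one_div_cancel hs.ne', one_mul, mul_sub, ← mul_assoc,
      mul_one_div_cancel hs.ne', one_mul]
    linarith
  have hU : 1 / ημ * rescaledKlDiv (fun _ : (Σ i, A i) => 1 / (Fintype.card (Σ i, A i) : ℝ)) u.2.2 +
      dotProduct τ.noise.2.2 u.2.2 ≤
      1 / ημ * (2 * Real.log (Fintype.card (Σ i, A i)) - 1 +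
      n * (ημ ^ 2 * (Fintype.card (Σ i, A i) * incrBound M d ^ 2)) +
      ∑ x, 1 / (Fintype.card (Σ i, A i) : ℝ) * (Real.exp (-(n * (ημ ^ 2 *
        (Fintype.card (Σ i, A i) * incrBound M d ^ 2)))) * Real.exp (ημ * τ.noise.2.2 x))) := by
    have h1 := neg_dotProduct_le_uniform huμ.1 (-(ημ • τ.noise.2.2))
      (n * (ημ ^ 2 * (Fintype.card (Σ i, A i) * incrBound M d ^ 2)))
    have h2 := rescaledKlDiv_uniform_le (r := 1) huμ.1 fun x =>
      (Finset.single_le_sum (fun x _ => huμ.1 x) (Finset.mem_univ x)).trans huμ.2.le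
    rw [huμ.2] at h1 h2
    rw [neg_dotProduct, smul_dotProduct, smul_eq_mul] at h1
    simp only [Pi.smul_apply, Pi.neg_apply, neg_neg, smul_eq_mul, one_mul] at h1 h2
    refine le_of_mul_le_mul_left ?_ hμ
    rw [← mul_assoc ημ (1 / ημ), mul_one_div_cancel hμ.ne', one_mul, mul_add, ← mul_assoc,
      mul_one_div_cancel hμ.ne', one_mul]
    linarith
  simp only [weightedDiv, signedPairing, startPoint] at hreg hw
  unfold regretBound
  linarith

theorem Trace.Invariant.gap_le (hfeas : IsFeasible M d) (h : IsAdmissible M d ηv ηs ημ)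
    (hv₁ : v₁ ∈ box S (2 * maxEntry d * M.mixTime)) {n : ℕ} (hn : 0 < n) {τ : Trace S A κ}
    (hτ : τ.Invariant M d ηv ηs ημ (startPoint A κ v₁) n) :
    gap M d ((1 / (n : ℝ)) • τ.total) ≤ 2 * (1 / n * regretBound M d ηv ηs ημ n τ) := by
  have hn' : (0 : ℝ) < n := by exact_mod_cast hn
  have h1 := h.one_le_maxEntry
  have h2 := h.one_le_mixTime
  refine gap_le_two_mul hfeas (by positivity) (fun k => ?_) fun u hu => ?_
  · have := hτ.total_s_nonneg k
    simp only [Prod.smul_snd, Prod.smul_fst, Pi.smul_apply, smul_eq_mul]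
    positivity
  · have h3 := mul_le_mul_of_nonneg_left (hτ.regret_le h hv₁ hu)
      (show (0 : ℝ) ≤ 1 / n by positivity)
    refine le_trans (le_of_eq ?_) h3
    simp only [objective, Prod.smul_snd, Prod.smul_fst, Matrix.mulVec_smul, smul_dotProduct,
      dotProduct_add, dotProduct_smul, smul_eq_mul, Pi.smul_apply, ← Finset.mul_sum]
    field_simp

/-- The noise terms add `ηv`, `2 ηs K D²` and `ημ |A| H²` per iteration to the costs `ηv`, `4 ηs K
D²` and `ημ |A| H²` of the mirror steps, with `H` the increment bound `incrBound`. -/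
theorem mean_regretBound_le (h : IsAdmissible M d ηv ηs ημ)
    (hv₁ : v₁ ∈ box S (2 * maxEntry d * M.mixTime)) (n : ℕ) :
    mean (trace M d ηv ηs ημ (startPoint A κ v₁) n) (regretBound M d ηv ηs ημ n) ≤
      1 / ηv * (5 / 2 * (Fintype.card S * (2 * maxEntry d * M.mixTime) ^ 2)) +
      1 / ηs * (4 * Real.log (2 * Fintype.card κ) + 2) +
      1 / ημ * (2 * Real.log (Fintype.card (Σ i, A i))) +
      n * (2 * ηv + 6 * (ηs * (Fintype.card κ * maxEntry d ^ 2)) +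
        2 * (ημ * (Fintype.card (Σ i, A i) * incrBound M d ^ 2))) := by
  have hf := finite_support_trace M d ηv ηs ημ (startPoint A κ v₁) n
  have hz₁ := isIterate_startPoint (A := A) (κ := κ) hv₁
  have hv := h.ηv_pos
  have hs := h.ηs_pos
  have hμ := h.ημ_pos
  have hK : (0 : ℝ) < Fintype.card κ := by exact_mod_cast Fintype.card_pos
  have hn : (0 : ℝ) < Fintype.card (Σ i, A i) := by exact_mod_cast Fintype.card_pos
  have h1 := mean_err_le h hz₁ n
  have h2 := mean_sum_sq_noise_le h hz₁ n
  have h3 : mean (trace M d ηv ηs ημ (startPoint A κ v₁) n) (fun τ =>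
      ∑ k, 1 / (Fintype.card κ : ℝ) * (Real.exp (-(n * (ηs ^ 2 *
        (Fintype.card κ * maxEntry d ^ 2)))) * Real.exp (-(ηs * τ.noise.2.1 k)))) ≤ 1 := by
    rw [mean_sum hf]
    calc _ ≤ ∑ _k : κ, 1 / (Fintype.card κ : ℝ) := by
          refine Finset.sum_le_sum fun k _ => ?_
          rw [mean_const_mul, mean_const_mul]
          refine mul_le_of_le_one_right (by positivity) ?_
          refine (mul_le_mul_of_nonneg_left (mean_exp_noise_s_le h hz₁ k n)
            (Real.exp_pos _).le).trans ?_
          rw [← Real.exp_add, neg_add_cancel, Real.exp_zero]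
      _ = 1 := by
          rw [Finset.sum_const, Finset.card_univ, nsmul_eq_mul, mul_one_div_cancel hK.ne']
  have h4 : mean (trace M d ηv ηs ημ (startPoint A κ v₁) n) (fun τ =>
      ∑ x, 1 / (Fintype.card (Σ i, A i) : ℝ) * (Real.exp (-(n * (ημ ^ 2 *
        (Fintype.card (Σ i, A i) * incrBound M d ^ 2)))) * Real.exp (ημ * τ.noise.2.2 x))) ≤ 1 := by
    rw [mean_sum hf]
    calc _ ≤ ∑ _x : (Σ i, A i), 1 / (Fintype.card (Σ i, A i) : ℝ) := by
          refine Finset.sum_le_sum fun x _ => ?_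
          rw [mean_const_mul, mean_const_mul]
          refine mul_le_of_le_one_right (by positivity) ?_
          refine (mul_le_mul_of_nonneg_left (mean_exp_noise_μ_le h hz₁ x n)
            (Real.exp_pos _).le).trans ?_
          rw [← Real.exp_add, neg_add_cancel, Real.exp_zero]
      _ = 1 := by
          rw [Finset.sum_const, Finset.card_univ, nsmul_eq_mul, mul_one_div_cancel hn.ne']
  unfold regretBound
  rw [mean_add hf, mean_add hf, mean_add hf, mean_add hf, mean_const, mean_const_mul,
    mean_const_mul, mean_const_mul, mean_add hf, mean_const, mean_add hf, mean_const]
  have e2 := mul_le_mul_of_nonneg_left h2 (show 0 ≤ ηv / 2 by positivity)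
  have e3 := mul_le_mul_of_nonneg_left h3 (show 0 ≤ 1 / ηs by positivity)
  have e4 := mul_le_mul_of_nonneg_left h4 (show 0 ≤ 1 / ημ by positivity)
  have e5 : 1 / ηs * (2 * (n * (ηs ^ 2 * (Fintype.card κ * maxEntry d ^ 2)))) =
      n * (2 * (ηs * (Fintype.card κ * maxEntry d ^ 2))) := by
    field_simp
  have e6 : 1 / ημ * (n * (ημ ^ 2 * (Fintype.card (Σ i, A i) * incrBound M d ^ 2))) =
      n * (ημ * (Fintype.card (Σ i, A i) * incrBound M d ^ 2)) := by
    field_simp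
  linarith

/-! ### The output of the algorithm and its number of samples -/

theorem law_smd (M : AMDP S A) (d : Matrix (Σ i, A i) κ ℝ) (ηv ηs ημ : ℝ) (v₁ : S → ℝ) {T : ℕ}
    (hT : 0 < T) :
    (smd M d ηv ηs ημ v₁ T).law =
      (trace M d ηv ηs ημ (startPoint A κ v₁) T).map fun τ => (1 / (T : ℝ)) • τ.total := by
  obtain ⟨n, rfl⟩ := Nat.exists_eq_succ_of_ne_zero hT.ne'
  have h := congrArg (PMF.map fun y : Point S A κ => (1 / ((n + 1 : ℕ) : ℝ)) • y)
    (law_smdLoop_snd M d ηv ηs ημ (startPoint A κ v₁) n)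
  rw [PMF.map_comp, PMF.map_comp] at h
  rw [smd, Sampling.law_bind]
  simp only [Sampling.law_ret]
  exact h

theorem hasCost_smdStep (M : AMDP S A) (d : Matrix (Σ i, A i) κ ℝ) (ηv ηs ημ : ℝ)
    (z : Point S A κ) : (smdStep M d ηv ηs ημ z).HasCost 2 := by
  obtain ⟨v, s, μ⟩ := z
  have h1 : (estV M (v, s, μ)).HasCost 1 := by
    simpa only [estV, zero_add, add_zero] using (Sampling.HasCost.internal _).bind fun x =>
      (M.hasCost_query x).bind fun j => Sampling.HasCost.ret _
  have h2 : (estS d (v, s, μ)).HasCost 0 := by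
    simpa only [estS, zero_add, add_zero] using (Sampling.HasCost.internal _).bind fun x =>
      (Sampling.HasCost.internal _).bind fun k => Sampling.HasCost.ret _
  have h3 : (estMu M d (v, s, μ)).HasCost 1 := by
    simpa only [estMu, zero_add, add_zero] using (Sampling.HasCost.internal _).bind fun x =>
      (M.hasCost_query x).bind fun j =>
        (Sampling.HasCost.internal _).bind fun k => Sampling.HasCost.ret _
  exact h1.bind fun gv => h2.bind fun gs => h3.bind fun gμ => Sampling.HasCost.ret _

theorem hasCost_smdLoop (M : AMDP S A) (d : Matrix (Σ i, A i) κ ℝ) (ηv ηs ημ : ℝ)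
    (z : Point S A κ) (n : ℕ) : (smdLoop M d ηv ηs ημ z n).HasCost (2 * n) := by
  induction n with
  | zero => exact Sampling.HasCost.ret _
  | succ n ih =>
    exact ih.bind fun y => (hasCost_smdStep M d ηv ηs ημ y.1).bind fun z => Sampling.HasCost.ret _

theorem hasCost_smd (M : AMDP S A) (d : Matrix (Σ i, A i) κ ℝ) (ηv ηs ημ : ℝ) (v₁ : S → ℝ)
    (T : ℕ) : (smd M d ηv ηs ημ v₁ T).HasCost (2 * (T - 1)) :=
  (hasCost_smdLoop M d ηv ηs ημ _ (T - 1)).bind fun _ => Sampling.HasCost.ret _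

theorem isExpectedApproxSolution_smd {ε : ℝ} (hfeas : IsFeasible M d)
    (h : IsAdmissible M d ηv ηs ημ) (hv₁ : v₁ ∈ box S (2 * maxEntry d * M.mixTime)) {T : ℕ}
    (hT : 0 < T) (hε : mean (trace M d ηv ηs ημ (startPoint A κ v₁) T)
      (regretBound M d ηv ηs ημ T) ≤ T * (ε / 2)) :
    IsExpectedApproxSolution M d ε (smd M d ηv ηs ημ v₁ T).law := by
  have hT' : (0 : ℝ) < T := by exact_mod_cast hT
  have hD := h.one_le_maxEntry
  have ht := h.one_le_mixTime
  have hf := finite_support_trace M d ηv ηs ημ (startPoint A κ v₁) T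
  have hinv := invariant_of_mem_support_trace h (isIterate_startPoint (A := A) (κ := κ) hv₁) T
  rw [law_smd M d ηv ηs ημ v₁ hT]
  refine ⟨fun z hz => ?_, summable_mean (finite_support_map _ hf) _, ?_⟩
  · rw [PMF.support_map] at hz
    obtain ⟨τ, hτ, rfl⟩ := hz
    have hi := hinv τ hτ
    refine ⟨⟨fun i => ?_, fun k => ?_, ?_⟩, fun x => ?_, ?_⟩ <;>
      simp only [Prod.smul_snd, Prod.smul_fst, Pi.smul_apply, smul_eq_mul, ← Finset.mul_sum]
    · have h1 := hi.abs_total_v i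
      rw [abs_mul, abs_of_pos (by positivity), one_div_mul_eq_div, div_le_iff₀ hT', boundM]
      have : 0 ≤ T * (2 * maxEntry d * M.mixTime) := by positivity
      linarith
    · have := hi.total_s_nonneg k
      positivity
    · rw [one_div_mul_eq_div, div_le_iff₀ hT']
      linarith [hi.sum_total_s]
    · have := hi.total_μ_nonneg x
      positivity
    · rw [hi.sum_total_μ, one_div_mul_cancel hT'.ne']
  · change mean _ (gap M d) ≤ ε
    rw [mean_map hf]
    calc _ ≤ mean (trace M d ηv ηs ημ (startPoint A κ v₁) T)
          -- The doubling of the box is why the average regret is required to be at most `ε / 2`.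
          (fun τ => 2 * (1 / T * regretBound M d ηv ηs ημ T τ)) :=
          mean_le_mean hf fun τ hτ => (hinv τ hτ).gap_le hfeas h hv₁ hT
      _ ≤ 2 * (1 / T * (T * (ε / 2))) := by
          rw [mean_const_mul, mean_const_mul]
          gcongr
      _ = ε := by field_simp

end Gap

/-! ## The choice of the constants -/

section Constants

set_option linter.unusedSectionVars false

variable {S : Type u} {A : S → Type v} {κ : Type w}
  [Fintype S] [DecidableEq S] [∀ i, Fintype (A i)] [∀ i, DecidableEq (A i)]
  [Fintype κ] [DecidableEq κ] [Nonempty S] [∀ i, Nonempty (A i)] [Nonempty κ]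

/-- The numerical inequality that determines the constants. -/
theorem regret_constants {σ n K D t H ε L T lK ln : ℝ} (hσ : σ ≤ n) (hn : 1 ≤ n)
    (hK : 1 ≤ K) (hD : 1 ≤ D) (ht : 1 ≤ t) (hH0 : 0 ≤ H) (hH : H ≤ 6 * (D * t)) (hε : 0 < ε)
    (hL : 1 / 2 ≤ L) (hlK : lK ≤ 2 * L) (hln : ln ≤ L)
    (hT : 12000 * ((t ^ 2 * n + K) * D ^ 2 / ε ^ 2 * L) ≤ T) :
    1 / (1 / 40 * ε) * (5 / 2 * (σ * (2 * D * t) ^ 2)) +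
      1 / (1 / 60 * ε / (K * D ^ 2)) * (4 * lK + 2) +
      1 / (1 / 720 * ε / (t ^ 2 * D ^ 2 * n)) * (2 * ln) +
      T * (2 * (1 / 40 * ε) + 6 * (1 / 60 * ε / (K * D ^ 2) * (K * D ^ 2)) +
        2 * (1 / 720 * ε / (t ^ 2 * D ^ 2 * n) * (n * H ^ 2))) ≤ T * (ε / 2) := by
  have hn0 : 0 < n := by linarith
  have hK0 : 0 < K := by linarith
  have hD0 : 0 < D := by linarith
  have ht0 : 0 < t := by linarith
  have hL0 : 0 < L := by linarith
  have hX : 0 ≤ t ^ 2 * n * D ^ 2 / ε := by positivity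
  have hY : 0 ≤ K * D ^ 2 / ε := by positivity
  -- Of the budget `T ε / 2`, the step-size terms use `T ε / 4` (`1/20 + 1/10 + 1/10`). The
  -- divergence terms must fit into the other `T ε / 4`, that is into `3000` times each summand:
  -- they need `800 + 1440` and `720`.
  have hTε : 12000 * ((t ^ 2 * n * D ^ 2 / ε) * L + (K * D ^ 2 / ε) * L) ≤ T * ε := by
    refine le_trans (le_of_eq ?_) (mul_le_mul_of_nonneg_right hT hε.le)
    field_simp
  have hT0 : 0 ≤ T := le_trans (by positivity) hT
  have e1 : 1 / (1 / 40 * ε) * (5 / 2 * (σ * (2 * D * t) ^ 2)) ≤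
      800 * ((t ^ 2 * n * D ^ 2 / ε) * L) := by
    calc _ = 400 * (t ^ 2 * σ * D ^ 2 / ε) := by field_simp; ring
      _ ≤ 400 * (t ^ 2 * n * D ^ 2 / ε) := by gcongr
      _ ≤ _ := by nlinarith
  have e2 : 1 / (1 / 60 * ε / (K * D ^ 2)) * (4 * lK + 2) ≤ 720 * ((K * D ^ 2 / ε) * L) := by
    calc _ = (K * D ^ 2 / ε) * (60 * (4 * lK + 2)) := by field_simp
      _ ≤ (K * D ^ 2 / ε) * (720 * L) := mul_le_mul_of_nonneg_left (by linarith) hY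
      _ = _ := by ring
  have e3 : 1 / (1 / 720 * ε / (t ^ 2 * D ^ 2 * n)) * (2 * ln) ≤
      1440 * ((t ^ 2 * n * D ^ 2 / ε) * L) := by
    calc _ = (t ^ 2 * n * D ^ 2 / ε) * (1440 * ln) := by field_simp; ring
      _ ≤ (t ^ 2 * n * D ^ 2 / ε) * (1440 * L) := mul_le_mul_of_nonneg_left (by linarith) hX
      _ = _ := by ring
  have e4 : 1 / 60 * ε / (K * D ^ 2) * (K * D ^ 2) = 1 / 60 * ε := by field_simp
  have e5 : 1 / 720 * ε / (t ^ 2 * D ^ 2 * n) * (n * H ^ 2) ≤ 1 / 20 * ε := by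
    calc _ ≤ 1 / 720 * ε / (t ^ 2 * D ^ 2 * n) * (n * (6 * (D * t)) ^ 2) := by gcongr
      _ = 1 / 20 * ε := by field_simp; norm_num
  have e6 : T * (2 * (1 / 40 * ε) + 6 * (1 / 60 * ε / (K * D ^ 2) * (K * D ^ 2)) +
        2 * (1 / 720 * ε / (t ^ 2 * D ^ 2 * n) * (n * H ^ 2))) ≤ T * (1 / 4 * ε) := by
    rw [e4]
    exact mul_le_mul_of_nonneg_left (by linarith) hT0
  have hXL : 0 ≤ (t ^ 2 * n * D ^ 2 / ε) * L := by positivity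
  have hYL : 0 ≤ (K * D ^ 2 / ε) * L := by positivity
  linarith

theorem incrBound_le {M : AMDP S A} {d : Matrix (Σ i, A i) κ ℝ} (hD : 1 ≤ maxEntry d)
    (ht : 1 ≤ M.mixTime) : incrBound M d ≤ 6 * (maxEntry d * M.mixTime) := by
  unfold incrBound
  nlinarith

theorem isAdmissible_stepSizes {M : AMDP S A} {d : Matrix (Σ i, A i) κ ℝ} (hd : ∀ x k, 0 ≤ d x k)
    (hD : 1 ≤ maxEntry d) (ht : 1 ≤ M.mixTime) {ε : ℝ} (hε : 0 < ε) (hε1 : ε < 1) :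
    IsAdmissible M d (1 / 40 * ε) (1 / 60 * ε / ((Fintype.card κ : ℝ) * maxEntry d ^ 2))
      (1 / 720 * ε / (M.mixTime ^ 2 * maxEntry d ^ 2 * (Fintype.card (Σ i, A i) : ℝ))) := by
  have hK : (0 : ℝ) < Fintype.card κ := by exact_mod_cast Fintype.card_pos
  have hn : (0 : ℝ) < Fintype.card (Σ i, A i) := by exact_mod_cast Fintype.card_pos
  have hD0 : 0 < maxEntry d := by linarith
  have ht0 : 0 < M.mixTime := by linarith
  refine ⟨hd, hD, ht, by positivity, by positivity, by positivity, ?_, ?_⟩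
  · calc _ = ε / 30 / maxEntry d := by field_simp; norm_num
      _ ≤ 1 := by
        rw [div_le_one hD0]
        linarith
  · have hDt : 1 ≤ maxEntry d * M.mixTime := one_le_mul_of_one_le_of_one_le hD ht
    calc _ ≤ 1 / 720 * ε / (M.mixTime ^ 2 * maxEntry d ^ 2 * (Fintype.card (Σ i, A i) : ℝ)) *
          (2 * (Fintype.card (Σ i, A i) * (6 * (maxEntry d * M.mixTime)))) := by
          gcongr
          exact incrBound_le hD ht
      _ = ε / 60 / (maxEntry d * M.mixTime) := by field_simp; norm_num
      _ ≤ 1 := by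
        rw [div_le_one (by positivity)]
        linarith

theorem card_le_card_sigma : Fintype.card S ≤ Fintype.card (Σ i, A i) :=
  Fintype.card_le_of_surjective Sigma.fst fun i => ⟨⟨i, Classical.arbitrary _⟩, rfl⟩

end Constants

end ConstrainedAMDP

end

/-! ### Assembly with explicit constants -/

theorem mainTheorem6 :
    ∃ cv cs cμ C B : ℝ, 0 < cv ∧ 0 < cs ∧ 0 < cμ ∧ 0 < C ∧ 0 < B ∧
      ∀ (S : Type u) (A : S → Type v) (κ : Type w)
        [Fintype S] [DecidableEq S] [∀ i, Fintype (A i)] [∀ i, DecidableEq (A i)]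
        [Fintype κ] [DecidableEq κ] [Nonempty S] [∀ i, Nonempty (A i)] [Nonempty κ]
        (M : AMDP S A) (d : Matrix (Σ i, A i) κ ℝ),
        M.IsMixing → (∀ x k, 0 ≤ d x k) → IsFeasible M d →
        2 ≤ Fintype.card κ * Fintype.card (Σ i, A i) →
        ∀ ε : ℝ, 0 < ε → ε < 1 →
        ∀ v₁ ∈ box S (2 * maxEntry d * M.mixTime),
          (∀ T : ℕ, C * rate M d ε ≤ (T : ℝ) →
            IsExpectedApproxSolution M d ε (smdWith cv cs cμ M d ε v₁ T).law) ∧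
          (∀ o ∈ PMF.support (smdWith cv cs cμ M d ε v₁ ⌈C * rate M d ε⌉₊),
            (o.2 : ℝ) ≤ B * rate M d ε) := by
  refine ⟨1 / 40, 1 / 60, 1 / 720, 12000, 24000, by norm_num, by norm_num, by norm_num,
    by norm_num, by norm_num, ?_⟩
  intro S A κ _ _ _ _ _ _ _ _ _ M d hM hd hfeas hcard ε hε hε1 v₁ hv₁
  have hD := one_le_maxEntry hfeas
  have ht := one_le_mixTime hM
  have hadm := isAdmissible_stepSizes hd hD ht hε hε1
  have hK : (1 : ℝ) ≤ Fintype.card κ := by exact_mod_cast Fintype.card_pos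
  have hn : (1 : ℝ) ≤ Fintype.card (Σ i, A i) := by exact_mod_cast Fintype.card_pos
  have hcard' : (2 : ℝ) ≤ (Fintype.card κ : ℝ) * (Fintype.card (Σ i, A i) : ℝ) := by
    exact_mod_cast hcard
  have hL2 : Real.log 2 ≤ Real.log ((Fintype.card κ : ℝ) * (Fintype.card (Σ i, A i) : ℝ)) :=
    Real.log_le_log (by norm_num) hcard'
  have hL : 1 / 2 ≤ Real.log ((Fintype.card κ : ℝ) * (Fintype.card (Σ i, A i) : ℝ)) := by
    linarith [Real.log_two_gt_d9]
  have hrate : 0 < rate M d ε := by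
    have : 0 < Real.log ((Fintype.card κ : ℝ) * (Fintype.card (Σ i, A i) : ℝ)) := by linarith
    unfold rate
    positivity
  constructor
  · intro T hT
    have hT0 : 0 < T := by
      have : (0 : ℝ) < T := lt_of_lt_of_le (by positivity) hT
      exact_mod_cast this
    refine isExpectedApproxSolution_smd hfeas hadm hv₁ hT0
      ((mean_regretBound_le hadm hv₁ T).trans ?_)
    refine regret_constants (by exact_mod_cast card_le_card_sigma) hn hK hD ht
      hadm.incrBound_pos.le (incrBound_le hD ht) hε hL ?_ ?_ hT
    · rw [Real.log_mul (by norm_num) (by positivity)]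
      have : Real.log (Fintype.card κ) ≤
          Real.log ((Fintype.card κ : ℝ) * (Fintype.card (Σ i, A i) : ℝ)) :=
        Real.log_le_log (by positivity) (le_mul_of_one_le_right (by positivity) hn)
      linarith
    · exact Real.log_le_log (by positivity) (le_mul_of_one_le_left (by positivity) hK)
  · intro o ho
    have h1 := hasCost_smd M d _ _ _ v₁ _ o ho
    have h2 := Nat.ceil_lt_add_one (show 0 ≤ 12000 * rate M d ε by positivity)
    have h3 : 0 < ⌈12000 * rate M d ε⌉₊ := Nat.ceil_pos.2 (by positivity)
    -- Two queries in each of `T - 1` iterations, and `⌈x⌉ - 1 < x`: the missing last iteration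
    -- absorbs the rounding, so `B = 2 C` suffices.
    rw [h1, Nat.cast_mul, Nat.cast_pred h3]
    push_cast
    linarith
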